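/- Let $F$ be Thompson's group: the group, under composition, of all piecewise linear homeomorphisms of $[0,1]$ onto itself that are differentiable except at finitely many dyadic rationals and whose slopes, on the intervals of differentiability, are integer powers of $2$. Let $F'$ be the commutator subgroup of $F$, and let $$D=\{f\in F : \text{there is } \delta\in(0,1) \text{ with } f(t)=t \text{ for all } t\in[\delta,1]\}.$$ For a set $I\subset\mathbb Z$ of consecutive integers let $G(I)$ be the group presented by generators $g_i$, $i\in I$, subject to the relations $$g_{i-1}g_ig_{i+1}=g_ig_{i+1}g_{i-1}g_i\quad (i-1,\,i,\,i+1\in I),\qquad [g_i,g_j]=1\quad (i,j\in I,\ |i-j|\ge 2).$$ **Theorem.** (i) If $I=\{0,1,\dots,n\}$ with $n\ge 4$, then $G(I)\cong F$. (ii) If $I=\mathbb Z$, then $G(I)\cong F'$. (iii) If $I=\mathbb N=\{0,1,2,\dots\}$, then $G(I)\cong D$. -/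

import Mathlib

namespace Thompson

open unitInterval

/-- A real number is a dyadic rational if it has the form `m / 2 ^ n` with `m` an integer. -/
def IsDyadic (x : ℝ) : Prop := ∃ (m : ℤ) (n : ℕ), x = m / 2 ^ n

/-- A homeomorphism `f` of `[0,1]` is piecewise linear with finitely many breakpoints, all of them
dyadic, and with all slopes powers of two: there is a finite set `S` of dyadic rationals such
that on each closed interval with no point of `S` in its interior, `f` is affine with slope
`2 ^ k` for some integer `k`. -/
def IsDyadicPL (f : I ≃ₜ I) : Prop :=
  ∃ S : Finset I, (∀ s ∈ S, IsDyadic s) ∧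
    ∀ a b : I, a < b → (∀ s ∈ S, s ∉ Set.Ioo a b) →
      ∃ (k : ℤ) (c : ℝ), ∀ x ∈ Set.Icc a b, (f x : ℝ) = (2 : ℝ) ^ k * x + c

theorem IsDyadic.zero : IsDyadic 0 := ⟨0, 0, by simp⟩

theorem IsDyadic.add {x y : ℝ} (hx : IsDyadic x) (hy : IsDyadic y) : IsDyadic (x + y) := by
  obtain ⟨m, n, rfl⟩ := hx
  obtain ⟨p, q, rfl⟩ := hy
  refine ⟨m * 2 ^ q + p * 2 ^ n, n + q, ?_⟩
  push_cast
  field_simp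
  ring

theorem IsDyadic.neg {x : ℝ} (hx : IsDyadic x) : IsDyadic (-x) := by
  obtain ⟨m, n, rfl⟩ := hx
  exact ⟨-m, n, by push_cast; ring⟩

theorem IsDyadic.sub {x y : ℝ} (hx : IsDyadic x) (hy : IsDyadic y) : IsDyadic (x - y) := by
  rw [sub_eq_add_neg]
  exact hx.add hy.neg

theorem IsDyadic.zpow_mul {x : ℝ} (k : ℤ) (hx : IsDyadic x) : IsDyadic ((2 : ℝ) ^ k * x) := by
  obtain ⟨m, n, rfl⟩ := hx
  obtain ⟨j, rfl | rfl⟩ := k.eq_nat_or_neg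
  · exact ⟨2 ^ j * m, n, by push_cast; rw [zpow_natCast]; ring⟩
  · refine ⟨m, n + j, ?_⟩
    rw [zpow_neg, zpow_natCast, pow_add]
    field_simp

theorem IsDyadicPL.strictMono {f : I ≃ₜ I} (hf : IsDyadicPL f) : StrictMono f := by
  rcases f.continuous.strictMono_of_inj f.injective with h | h
  · exact h
  · exfalso
    obtain ⟨S, -, hS⟩ := hf
    -- the least element of `S ∪ {1}` that is positive
    let T : Finset I := (insert 1 S).filter (fun s => 0 < s)
    have hT : T.Nonempty := ⟨1, by simp [T]⟩
    have hb : 0 < T.min' hT := (Finset.mem_filter.1 (T.min'_mem hT)).2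
    obtain ⟨k, c, hk⟩ := hS 0 (T.min' hT) hb (fun s hs hs' =>
      absurd (T.min'_le s (by simp [T, hs, hs'.1])) (not_le.2 hs'.2))
    have h0 := hk 0 ⟨le_rfl, hb.le⟩
    have h1 := hk _ ⟨hb.le, le_rfl⟩
    have h2 : (f (T.min' hT) : ℝ) < f 0 := h hb
    have h3 : (0 : ℝ) < 2 ^ k * (T.min' hT : ℝ) := mul_pos (by positivity) hb
    simp only [Set.Icc.coe_zero] at h0
    linarith

theorem IsDyadicPL.map_zero {f : I ≃ₜ I} (hf : IsDyadicPL f) : f 0 = 0 := by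
  obtain ⟨y, hy⟩ := f.surjective 0
  refine le_antisymm ?_ unitInterval.nonneg'
  have h := hf.strictMono.monotone (unitInterval.nonneg' : 0 ≤ y)
  rwa [hy] at h

/-- Each positive point is joined, by an interval on which `f` is affine, to a smaller dyadic
point. -/
theorem exists_left {f : I ≃ₜ I} {S : Finset I}
    (hS : ∀ a b : I, a < b → (∀ s ∈ S, s ∉ Set.Ioo a b) →
      ∃ (k : ℤ) (c : ℝ), ∀ x ∈ Set.Icc a b, (f x : ℝ) = (2 : ℝ) ^ k * x + c)
    (x : I) (hx : 0 < x) :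
    ∃ t ∈ insert 0 S, t < x ∧ ∃ k : ℤ, (f x : ℝ) - f t = (2 : ℝ) ^ k * (x - t) := by
  let T : Finset I := (insert 0 S).filter (fun s => s < x)
  have hT : T.Nonempty := ⟨0, by simp [T, hx]⟩
  obtain ⟨hm, hlt⟩ := Finset.mem_filter.1 (T.max'_mem hT)
  obtain ⟨k, c, hk⟩ := hS (T.max' hT) x hlt (fun s hs hs' =>
    absurd (T.le_max' s (by simp [T, hs, hs'.2])) (not_le.2 hs'.1))
  refine ⟨_, hm, hlt, k, ?_⟩
  rw [hk _ ⟨hlt.le, le_rfl⟩, hk _ ⟨le_rfl, hlt.le⟩]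
  ring

theorem IsDyadicPL.isDyadic_apply {f : I ≃ₜ I} (hf : IsDyadicPL f) {x : I}
    (hx : IsDyadic x) : IsDyadic (f x) := by
  have h0 := hf.map_zero
  obtain ⟨S, hd, hS⟩ := hf
  have key : ∀ (n : ℕ) (x : I), ((insert 0 S).filter (fun s => s < x)).card ≤ n →
      IsDyadic x → IsDyadic (f x) := by
    intro n
    induction n with
    | zero =>
      intro x hn hx
      rcases (unitInterval.nonneg' : 0 ≤ x).eq_or_lt with h | h
      · rw [← h, h0]; exact IsDyadic.zero
      · exfalso
        rw [Nat.le_zero, Finset.card_eq_zero] at hn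
        have : (0 : I) ∈ (insert 0 S).filter (fun s => s < x) := by simp [h]
        rw [hn] at this
        simp at this
    | succ n ih =>
      intro x hn hx
      rcases (unitInterval.nonneg' : 0 ≤ x).eq_or_lt with h | h
      · rw [← h, h0]; exact IsDyadic.zero
      · obtain ⟨t, ht, htx, k, hk⟩ := exists_left hS x h
        have htd : IsDyadic t := by
          rcases Finset.mem_insert.1 ht with rfl | ht
          · exact IsDyadic.zero
          · exact hd t ht
        have hlt : ((insert 0 S).filter (fun s => s < t)).card <
            ((insert 0 S).filter (fun s => s < x)).card := by
          refine Finset.card_lt_card ⟨?_, fun hsub => ?_⟩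
          · intro s hs
            rw [Finset.mem_filter] at hs ⊢
            exact ⟨hs.1, hs.2.trans htx⟩
          · exact lt_irrefl t (Finset.mem_filter.1 (hsub (Finset.mem_filter.2 ⟨ht, htx⟩))).2
        have := (ih t (by omega) htd).add ((hx.sub htd).zpow_mul k)
        rwa [← hk, add_sub_cancel] at this
  exact key _ x le_rfl hx

theorem IsDyadicPL.isDyadic_of_apply {f : I ≃ₜ I} (hf : IsDyadicPL f) {x : I}
    (hx : IsDyadic (f x)) : IsDyadic x := by
  rcases (unitInterval.nonneg' : 0 ≤ x).eq_or_lt with h | h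
  · rw [← h]; exact IsDyadic.zero
  · have hf' := hf
    obtain ⟨S, hd, hS⟩ := hf
    obtain ⟨t, ht, htx, k, hk⟩ := exists_left hS x h
    have htd : IsDyadic t := by
      rcases Finset.mem_insert.1 ht with rfl | ht
      · exact IsDyadic.zero
      · exact hd t ht
    have := htd.add ((hx.sub (hf'.isDyadic_apply htd)).zpow_mul (-k))
    rwa [hk, ← mul_assoc, ← zpow_add₀ (two_ne_zero), neg_add_cancel, zpow_zero, one_mul,
      add_sub_cancel] at this

theorem IsDyadicPL.one : IsDyadicPL 1 :=
  ⟨∅, by simp, fun _ _ _ _ => ⟨0, 0, fun x _ => by simp⟩⟩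

theorem IsDyadicPL.mul {f g : I ≃ₜ I} (hf : IsDyadicPL f) (hg : IsDyadicPL g) :
    IsDyadicPL (f * g) := by
  have hgm := hg.strictMono
  have hgd := fun x => hg.isDyadic_of_apply (x := x)
  obtain ⟨S, hSd, hS⟩ := hf
  obtain ⟨T, hTd, hT⟩ := hg
  refine ⟨T ∪ S.image g.symm, ?_, ?_⟩
  · intro s hs
    rcases Finset.mem_union.1 hs with hs | hs
    · exact hTd s hs
    · obtain ⟨r, hr, rfl⟩ := Finset.mem_image.1 hs
      exact hgd _ (by simpa using hSd r hr)
  · intro a b hab h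
    obtain ⟨k, c, hk⟩ := hT a b hab (fun s hs => h s (Finset.mem_union_left _ hs))
    obtain ⟨l, d, hl⟩ := hS (g a) (g b) (hgm hab) (fun s hs hs' =>
      h (g.symm s) (Finset.mem_union_right _ (Finset.mem_image_of_mem _ hs))
        ⟨hgm.lt_iff_lt.1 (by simpa using hs'.1), hgm.lt_iff_lt.1 (by simpa using hs'.2)⟩)
    refine ⟨l + k, (2 : ℝ) ^ l * c + d, fun x hx => ?_⟩
    rw [show (f * g) x = f (g x) from rfl,
      hl _ ⟨hgm.monotone hx.1, hgm.monotone hx.2⟩, hk x hx, zpow_add₀ two_ne_zero]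
    ring

theorem IsDyadicPL.inv {f : I ≃ₜ I} (hf : IsDyadicPL f) : IsDyadicPL f⁻¹ := by
  have hfm := hf.strictMono
  have hfd := fun x => hf.isDyadic_apply (x := x)
  obtain ⟨S, hSd, hS⟩ := hf
  refine ⟨S.image f, ?_, ?_⟩
  · intro s hs
    obtain ⟨r, hr, rfl⟩ := Finset.mem_image.1 hs
    exact hfd _ (hSd r hr)
  · intro a b hab h
    obtain ⟨a, rfl⟩ := f.surjective a
    obtain ⟨b, rfl⟩ := f.surjective b
    obtain ⟨k, c, hk⟩ := hS a b (hfm.lt_iff_lt.1 hab) (fun s hs hs' =>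
      h (f s) (Finset.mem_image_of_mem _ hs) ⟨hfm hs'.1, hfm hs'.2⟩)
    refine ⟨-k, -((2 : ℝ) ^ (-k) * c), fun x hx => ?_⟩
    obtain ⟨x, rfl⟩ := f.surjective x
    rw [show f⁻¹ (f x) = x from f.symm_apply_apply x,
      hk x ⟨hfm.le_iff_le.1 hx.1, hfm.le_iff_le.1 hx.2⟩, mul_add, ← mul_assoc,
      ← zpow_add₀ two_ne_zero, neg_add_cancel, zpow_zero]
    ring

/-- Thompson's group `F`, as a group (under composition) of homeomorphisms of `[0,1]`. -/
def F : Subgroup (I ≃ₜ I) where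
  carrier := {f | IsDyadicPL f}
  mul_mem' := IsDyadicPL.mul
  one_mem' := IsDyadicPL.one
  inv_mem' := IsDyadicPL.inv

/-- The intermediate group `D`: the elements of `F` that are the identity on `[δ,1]` for some
`δ ∈ (0,1)`. -/
def D : Subgroup F where
  carrier := {f | ∃ δ ∈ Set.Ioo (0 : I) 1, ∀ x ∈ Set.Icc δ 1, f.1 x = x}
  mul_mem' := by
    rintro f g ⟨δ, hδ, hf⟩ ⟨ε, hε, hg⟩
    refine ⟨max δ ε, ⟨lt_max_of_lt_left hδ.1, max_lt hδ.2 hε.2⟩, fun x hx => ?_⟩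
    rw [show (f * g).1 x = f.1 (g.1 x) from rfl, hg x ⟨(le_max_right _ _).trans hx.1, hx.2⟩,
      hf x ⟨(le_max_left _ _).trans hx.1, hx.2⟩]
  one_mem' := ⟨⟨1 / 2, by norm_num, by norm_num⟩,
    ⟨by rw [← Subtype.coe_lt_coe]; norm_num, by rw [← Subtype.coe_lt_coe]; norm_num⟩,
    fun _ _ => rfl⟩
  inv_mem' := by
    rintro f ⟨δ, hδ, hf⟩
    refine ⟨δ, hδ, fun x hx => ?_⟩
    conv_lhs => rw [← hf x hx]
    exact f.1.symm_apply_apply x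

/-- The relators, for a set `J` of integers, that express the relations
`g_{i-1} g_i g_{i+1} = g_i g_{i+1} g_{i-1} g_i` for `i - 1, i, i + 1 ∈ J` and
`[g_i, g_j] = 1` for `i, j ∈ J` with `|i - j| ≥ 2`. -/
def relators (J : Set ℤ) : Set (FreeGroup J) :=
  {r | ∃ a b c : J, (a : ℤ) = b - 1 ∧ (c : ℤ) = b + 1 ∧
      r = (FreeGroup.of a * FreeGroup.of b * FreeGroup.of c) *
        (FreeGroup.of b * FreeGroup.of c * FreeGroup.of a * FreeGroup.of b)⁻¹} ∪
  {r | ∃ i j : J, 2 ≤ |(i : ℤ) - j| ∧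
      r = FreeGroup.of i * FreeGroup.of j * (FreeGroup.of i)⁻¹ * (FreeGroup.of j)⁻¹}

/-- The group generated by `g_i`, `i ∈ J`, subject to the relations above. -/
abbrev G (J : Set ℤ) : Type := PresentedGroup (relators J)

end Thompson

/-!
Thompson's group `F` is generated by the homeomorphisms `X n`, `n ∈ ℕ`, where `X n` is the identity
on `[0, 1 - 2⁻ⁿ]` and has slopes `1/2`, `1`, `2` on the rest; they satisfy
`X j * X i = X i * X (j + 1)` for `i < j`. The generators `g i` of the presentations correspond to
`bump i = X i * (X (i + 1))⁻¹`, whose support `[1 - 2⁻ⁱ, 1 - 2⁻ⁱ⁻²]` overlaps only the supports of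
its neighbours; conversely `X i = g i * g (i + 1) * ⋯ * g n` if the last generator `g n` corresponds to `X n` itself.

Two facts about `F` carry the proof.

* The `X n` generate `F` (`closure_range_X`). An element of `F` maps all short standard dyadic
  intervals affinely onto standard dyadic intervals. Composing with an element that takes the
  subdivision at the points `1 - 2⁻ⁱ` to an equidistant one, one may assume that the leaves of the
  former have standard images; a shortest image then has its sibling next to it, and composing with
  some `(X i)⁻¹` merges the two leaves.
* A group generated by elements with the relations of the `X n` maps injectively to `F`
  (`injective_of_map_eq_X`). By the Ore condition it consists of quotients of positive words, and
  the smallest index in a positive word can be read off the fixed points of the homeomorphism.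

For `{0, …, n}` with `n ≥ 4`, the partial products `g i * ⋯ * g n` satisfy enough of the relations
of Thompson's group to imply all of them (`relations_of_two`), which gives `G {0, …, n} ≃ F`.

For `ℕ`, each element of `G ℕ` comes from some `G {0, …, n}`. On that group the homomorphism `g i ↦
bump i` differs from the isomorphism with `F` only in the last generator, and the injective map
`squeeze (n + 1)` of the interval intertwines the two, whence injectivity. The image is `D`: it is
normal in `F`, the quotient is generated by `X 0`, and no nontrivial power of `X 0` is in `D`.

For `ℤ`, the bumps are extended to negative indices by conjugation with `X 0`. Up to such a
conjugation each element of `G ℤ` comes from `G ℕ` with indices shifted by one, which the map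
`t ↦ (1 + t) / 2` reduces to the case of `ℕ`. The image is normal with abelian quotient, and it is
generated by elements that the relations make trivial in every abelian group; so it is the
commutator subgroup.
-/

namespace Thompson

open unitInterval

/-! ### The standard generators -/

/-- For `e = 2⁻ⁿ`, the generator `X n` of Thompson's group as a function: the identity on
`[0, 1 - e]`, then of slopes `1/2`, `1`, `2` on `[1 - e, 1 - e/2]`, `[1 - e/2, 1 - e/4]`,
`[1 - e/4, 1]`. -/
noncomputable def genFun (e t : ℝ) : ℝ :=
  max (min t ((1 + t - e) / 2)) (max (t - e / 4) (2 * t - 1))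

/-- The inverse function of `genFun e`. -/
noncomputable def genInv (e t : ℝ) : ℝ :=
  min (max t (2 * t - 1 + e)) (min (t + e / 4) ((1 + t) / 2))

section pieces

variable {e t : ℝ}

theorem genFun_of_le (he : 0 < e) (h : t ≤ 1 - e) : genFun e t = t := by
  rw [genFun, min_eq_left (by linarith), max_eq_left (max_le (by linarith) (by linarith))]

theorem genFun_half (h : 1 - e ≤ t) (h' : t ≤ 1 - e / 2) : genFun e t = (1 + t - e) / 2 := by
  rw [genFun, min_eq_right (by linarith), max_eq_left (max_le (by linarith) (by linarith))]

theorem genFun_shift (he : 0 < e) (h : 1 - e / 2 ≤ t) (h' : t ≤ 1 - e / 4) :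
    genFun e t = t - e / 4 := by
  rw [genFun, min_eq_right (by linarith), max_eq_left (by linarith : 2 * t - 1 ≤ t - e / 4),
    max_eq_right (by linarith)]

theorem genFun_double (he : 0 < e) (h : 1 - e / 4 ≤ t) : genFun e t = 2 * t - 1 := by
  rw [genFun, min_eq_right (by linarith), max_eq_right (by linarith : t - e / 4 ≤ 2 * t - 1),
    max_eq_right (by linarith)]

theorem genInv_of_le (he : 0 < e) (h : t ≤ 1 - e) : genInv e t = t := by
  rw [genInv, max_eq_left (by linarith), min_eq_left (le_min (by linarith) (by linarith))]

theorem genInv_double (h : 1 - e ≤ t) (h' : t ≤ 1 - 3 * e / 4) : genInv e t = 2 * t - 1 + e := by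
  rw [genInv, max_eq_right (by linarith), min_eq_left (le_min (by linarith) (by linarith))]

theorem genInv_shift (he : 0 < e) (h : 1 - 3 * e / 4 ≤ t) (h' : t ≤ 1 - e / 2) :
    genInv e t = t + e / 4 := by
  rw [genInv, max_eq_right (by linarith), min_eq_left (by linarith : t + e / 4 ≤ (1 + t) / 2),
    min_eq_right (by linarith)]

theorem genInv_half (he : 0 < e) (h : 1 - e / 2 ≤ t) : genInv e t = (1 + t) / 2 := by
  rw [genInv, max_eq_right (by linarith), min_eq_right (by linarith : (1 + t) / 2 ≤ t + e / 4),
    min_eq_right (by linarith)]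

theorem genInv_genFun (he : 0 < e) (t : ℝ) : genInv e (genFun e t) = t := by
  rcases le_total t (1 - e) with h1 | h1
  · rw [genFun_of_le he h1, genInv_of_le he h1]
  rcases le_total t (1 - e / 2) with h2 | h2
  · rw [genFun_half h1 h2, genInv_double (by linarith) (by linarith)]; ring
  rcases le_total t (1 - e / 4) with h3 | h3
  · rw [genFun_shift he h2 h3, genInv_shift he (by linarith) (by linarith)]; ring
  · rw [genFun_double he h3, genInv_half he (by linarith)]; ring

theorem genFun_genInv (he : 0 < e) (t : ℝ) : genFun e (genInv e t) = t := by
  rcases le_total t (1 - e) with h1 | h1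
  · rw [genInv_of_le he h1, genFun_of_le he h1]
  rcases le_total t (1 - 3 * e / 4) with h2 | h2
  · rw [genInv_double h1 h2, genFun_half (by linarith) (by linarith)]; ring
  rcases le_total t (1 - e / 2) with h3 | h3
  · rw [genInv_shift he h2 h3, genFun_shift he (by linarith) (by linarith)]; ring
  · rw [genInv_half he h3, genFun_double he (by linarith)]; ring

theorem genFun_le (he : 0 < e) (ht : t ≤ 1) : genFun e t ≤ t :=
  max_le (min_le_left _ _) (max_le (by linarith) (by linarith))

theorem genFun_lt (h : 1 - e < t) (ht : t < 1) : genFun e t < t :=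
  max_lt (min_lt_of_right_lt (by linarith)) (max_lt (by linarith) (by linarith))

theorem genFun_nonneg (he : e ≤ 1) (ht : 0 ≤ t) : 0 ≤ genFun e t :=
  le_max_of_le_left (le_min ht (by linarith))

theorem genInv_le_one (ht : t ≤ 1) : genInv e t ≤ 1 :=
  min_le_of_right_le (min_le_of_right_le (by linarith))

theorem genInv_nonneg (he : 0 < e) (ht : 0 ≤ t) : 0 ≤ genInv e t :=
  le_min (le_max_of_le_left ht) (le_min (by linarith) (by linarith))

theorem genFun_two_mul_sub_one (d t : ℝ) :
    genFun d (2 * t - 1) = 2 * genFun (d / 2) t - 1 := by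
  simp only [genFun, max_def, min_def]
  split_ifs <;> linarith

/-- The defining relation of Thompson's group, on the level of functions. -/
theorem genFun_comp {d : ℝ} (he : 0 < e) (hd : 0 < d) (hde : d ≤ e / 2) :
    genFun d (genFun e t) = genFun e (genFun (d / 2) t) := by
  rcases le_total t (1 - e / 4) with h | h
  · have h1 : genFun e t ≤ 1 - d := by
      refine le_trans ?_ (by linarith : 1 - e / 2 ≤ 1 - d)
      exact max_le (min_le_of_right_le (by linarith)) (max_le (by linarith) (by linarith))
    rw [genFun_of_le (by linarith : 0 < d / 2) (by linarith), genFun_of_le hd h1]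
  · have h1 : 1 - e / 4 ≤ genFun (d / 2) t := by
      rcases le_total t (1 - d / 2) with h2 | h2
      · rwa [genFun_of_le (by linarith) h2]
      · exact le_max_of_le_left (le_min h (by linarith))
    rw [genFun_double he h, genFun_double he h1, genFun_two_mul_sub_one]

end pieces

theorem half_pow_pos (n : ℕ) : (0 : ℝ) < (1 / 2) ^ n := by positivity

theorem half_pow_le_one (n : ℕ) : ((1 : ℝ) / 2) ^ n ≤ 1 :=
  pow_le_one₀ (by norm_num) (by norm_num)

theorem half_pow_succ (n : ℕ) : ((1 : ℝ) / 2) ^ (n + 1) = (1 / 2) ^ n / 2 := by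
  rw [pow_succ]; ring

theorem half_pow_add_two (n : ℕ) : ((1 : ℝ) / 2) ^ (n + 2) = (1 / 2) ^ n / 4 := by
  rw [pow_add]; ring

theorem half_pow_add_three (n : ℕ) : ((1 : ℝ) / 2) ^ (n + 3) = (1 / 2) ^ n / 8 := by
  rw [pow_add]; ring

theorem half_pow_anti {m n : ℕ} (h : m ≤ n) : ((1 : ℝ) / 2) ^ n ≤ (1 / 2) ^ m :=
  pow_le_pow_of_le_one (by norm_num) (by norm_num) h

/-- The generator `X n` as a homeomorphism of the unit interval. -/
noncomputable def genHomeo (n : ℕ) : I ≃ₜ I where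
  toFun t := ⟨genFun ((1 / 2) ^ n) t, genFun_nonneg (half_pow_le_one n) t.2.1,
    (genFun_le (half_pow_pos n) t.2.2).trans t.2.2⟩
  invFun t := ⟨genInv ((1 / 2) ^ n) t, genInv_nonneg (half_pow_pos n) t.2.1,
    genInv_le_one t.2.2⟩
  left_inv t := Subtype.ext (genInv_genFun (half_pow_pos n) t)
  right_inv t := Subtype.ext (genFun_genInv (half_pow_pos n) t)
  continuous_toFun := by unfold genFun; fun_prop
  continuous_invFun := by unfold genInv; fun_prop

theorem isDyadic_one_sub (n : ℕ) : IsDyadic (1 - (1 / 2) ^ n) :=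
  ⟨2 ^ n - 1, n, by push_cast; rw [one_div, inv_pow]; field_simp⟩

/-- The dyadic point `1 - 2⁻ⁿ` of the unit interval. -/
noncomputable def vertex (n : ℕ) : I :=
  ⟨1 - (1 / 2) ^ n, sub_nonneg.2 (half_pow_le_one n), by linarith [half_pow_pos n]⟩

theorem isDyadicPL_genHomeo (n : ℕ) : IsDyadicPL (genHomeo n) := by
  have he := half_pow_pos n
  have h1 := half_pow_succ n
  have h2 := half_pow_succ (n + 1)
  refine ⟨{vertex n, vertex (n + 1), vertex (n + 2)}, ?_, ?_⟩
  · simp only [Finset.mem_insert, Finset.mem_singleton]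
    rintro s (rfl | rfl | rfl) <;> exact isDyadic_one_sub _
  · intro a b hab h
    have key : ∀ m, vertex m ∈ ({vertex n, vertex (n + 1), vertex (n + 2)} : Finset I) →
        (a : ℝ) < 1 - (1 / 2) ^ m → (b : ℝ) ≤ 1 - (1 / 2) ^ m := fun m hm ha =>
      not_lt.1 fun hb => h _ hm ⟨ha, hb⟩
    have k0 := key n (by simp)
    have k1 := key (n + 1) (by simp)
    have k2 := key (n + 2) (by simp)
    rw [h1] at k1
    rw [show n + 2 = n + 1 + 1 from rfl, h2, h1] at k2
    set e : ℝ := (1 / 2) ^ n with hedef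
    change ∃ (k : ℤ) (c : ℝ), ∀ x ∈ Set.Icc a b, genFun e x = 2 ^ k * x + c
    rcases lt_or_ge (a : ℝ) (1 - e) with h0 | h0
    · refine ⟨0, 0, fun x hx => ?_⟩
      have hxb : (x : ℝ) ≤ b := hx.2
      rw [genFun_of_le he (hxb.trans (k0 h0))]
      simp
    rcases lt_or_ge (a : ℝ) (1 - e / 2) with h3 | h3
    · refine ⟨-1, (1 - e) / 2, fun x hx => ?_⟩
      have hxb : (x : ℝ) ≤ b := hx.2
      have hxa : (a : ℝ) ≤ x := hx.1
      rw [genFun_half (h0.trans hxa) (hxb.trans (k1 h3)), zpow_neg_one]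
      ring
    rcases lt_or_ge (a : ℝ) (1 - e / 2 / 2) with h4 | h4
    · refine ⟨0, - e / 4, fun x hx => ?_⟩
      have hxb : (x : ℝ) ≤ b := hx.2
      have hxa : (a : ℝ) ≤ x := hx.1
      rw [genFun_shift he (h3.trans hxa) (by linarith [k2 h4])]
      simp; ring
    · refine ⟨1, -1, fun x hx => ?_⟩
      have hxa : (a : ℝ) ≤ x := hx.1
      rw [genFun_double he (by linarith)]
      simp; ring

/-- The `n`-th standard generator of Thompson's group `F`. -/
noncomputable def X (n : ℕ) : F := ⟨genHomeo n, isDyadicPL_genHomeo n⟩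

theorem coe_X (n : ℕ) (t : I) : ((X n).1 t : ℝ) = genFun ((1 / 2) ^ n) t := rfl

theorem coe_X_inv (n : ℕ) (t : I) : ((X n)⁻¹.1 t : ℝ) = genInv ((1 / 2) ^ n) t := rfl

theorem mul_val_apply (f g : F) (t : I) : (f * g).1 t = f.1 (g.1 t) := rfl

theorem inv_val_apply_val (f : F) (t : I) : f⁻¹.1 (f.1 t) = t := f.1.symm_apply_apply t

theorem val_apply_inv_val (f : F) (t : I) : f.1 (f⁻¹.1 t) = t := f.1.apply_symm_apply t

theorem F_ext {f g : F} (h : ∀ t, f.1 t = g.1 t) : f = g := Subtype.ext (Homeomorph.ext h)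

/-- Thompson's relations: `X i` conjugates `X j` to `X (j + 1)` for `i < j`. -/
theorem X_mul_X {i j : ℕ} (h : i < j) : X j * X i = X i * X (j + 1) := by
  refine F_ext fun t => Subtype.ext ?_
  rw [mul_val_apply, mul_val_apply, coe_X, coe_X, coe_X, coe_X, half_pow_succ]
  refine genFun_comp (half_pow_pos _) (half_pow_pos _) ?_
  rw [← half_pow_succ]
  exact half_pow_anti h

theorem X_apply_of_le {n : ℕ} {t : I} (h : t ≤ vertex n) : (X n).1 t = t :=
  Subtype.ext (genFun_of_le (half_pow_pos n) h)

theorem X_apply_le (n : ℕ) (t : I) : (X n).1 t ≤ t :=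
  genFun_le (half_pow_pos n) t.2.2

theorem X_apply_lt {n : ℕ} {t : I} (h : vertex n < t) (h' : t < 1) : (X n).1 t < t :=
  genFun_lt h h'

theorem vertex_lt_one (n : ℕ) : vertex n < 1 :=
  show (1 : ℝ) - (1 / 2) ^ n < 1 by linarith [half_pow_pos n]

theorem vertex_zero : vertex 0 = 0 :=
  Subtype.ext (show (1 : ℝ) - (1 / 2) ^ 0 = 0 by norm_num)

theorem vertex_strictMono : StrictMono vertex :=
  strictMono_nat_of_lt_succ fun n => show (1 : ℝ) - (1 / 2) ^ n < 1 - (1 / 2) ^ (n + 1) by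
    rw [half_pow_succ]; linarith [half_pow_pos n]

/-- The injection of the unit interval into itself that is the identity on `[0, 1 - 2⁻ᵐ]` and
contracts `[1 - 2⁻ᵐ, 1]` to its left half. Conjugation by it truncates the last generator. -/
noncomputable def squeeze (m : ℕ) (t : I) : I :=
  ⟨min t ((1 - (1 / 2) ^ m + t) / 2), le_min t.2.1 (by
    linarith [half_pow_le_one m, t.2.1]), min_le_of_left_le t.2.2⟩

theorem coe_squeeze (m : ℕ) (t : I) :
    (squeeze m t : ℝ) = min (t : ℝ) ((1 - (1 / 2) ^ m + t) / 2) := rfl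

theorem squeeze_injective (m : ℕ) : Function.Injective (squeeze m) := by
  intro s t h
  have h' := congrArg (Subtype.val : I → ℝ) h
  rw [coe_squeeze, coe_squeeze] at h'
  refine Subtype.ext ?_
  simp only [min_def] at h'
  split_ifs at h' <;> linarith

theorem X_squeeze_of_lt {i m : ℕ} (h : i < m) (t : I) :
    (X i).1 (squeeze (m + 1) t) = squeeze m ((X i).1 t) := by
  refine Subtype.ext ?_
  rw [coe_X, coe_squeeze, coe_squeeze, coe_X, half_pow_succ]
  have he := half_pow_pos i
  have hd := half_pow_pos m
  have hde : ((1 : ℝ) / 2) ^ m ≤ (1 / 2) ^ i / 2 := by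
    rw [← half_pow_succ]; exact half_pow_anti h
  set e : ℝ := (1 / 2) ^ i
  set d : ℝ := (1 / 2) ^ m
  have ht : (t : ℝ) ≤ 1 := t.2.2
  rcases le_total (t : ℝ) (1 - e / 4) with h1 | h1
  · rw [min_eq_left (by linarith), min_eq_left]
    have : genFun e t ≤ 1 - e / 2 :=
      max_le (min_le_of_right_le (by linarith)) (max_le (by linarith) (by linarith))
    linarith
  · rw [genFun_double he h1, genFun_double he (le_min h1 (by linarith))]
    simp only [min_def]
    split_ifs <;> linarith

theorem X_squeeze_self (m : ℕ) (t : I) : (X m).1 (squeeze (m + 1) t) = squeeze m t := by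
  refine Subtype.ext ?_
  rw [coe_X, coe_squeeze, coe_squeeze, half_pow_succ]
  have he := half_pow_pos m
  set e : ℝ := (1 / 2) ^ m
  have ht : (t : ℝ) ≤ 1 := t.2.2
  rcases le_total (t : ℝ) (1 - e) with h1 | h1
  · rw [min_eq_left (by linarith), min_eq_left (by linarith), genFun_of_le he h1]
  rcases le_total (t : ℝ) (1 - e / 2) with h2 | h2
  · rw [min_eq_left (by linarith), min_eq_right (by linarith), genFun_half h1 h2]
    ring
  · rw [min_eq_right (by linarith), min_eq_right (by linarith),
      genFun_shift he (by linarith) (by linarith)]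
    ring

/-- The affine map of the unit interval onto its right half. -/
noncomputable def toRightHalf (t : I) : I := ⟨(1 + t) / 2, by linarith [t.2.1], by linarith [t.2.2]⟩

theorem toRightHalf_injective : Function.Injective toRightHalf := by
  intro s t h
  have h' : (1 + (s : ℝ)) / 2 = (1 + t) / 2 := congrArg (Subtype.val : I → ℝ) h
  exact Subtype.ext (by linarith)

theorem X_toRightHalf (n : ℕ) (t : I) :
    (X (n + 1)).1 (toRightHalf t) = toRightHalf ((X n).1 t) := by
  refine Subtype.ext ?_
  change genFun ((1 / 2) ^ (n + 1)) ((1 + t) / 2) = (1 + genFun ((1 / 2) ^ n) t) / 2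
  have := genFun_two_mul_sub_one ((1 / 2) ^ n) ((1 + (t : ℝ)) / 2)
  rw [show 2 * ((1 + (t : ℝ)) / 2) - 1 = t by ring, ← half_pow_succ] at this
  rw [this]; ring

theorem X_apply_eq_X_succ_apply {n : ℕ} {t : I} (h : vertex (n + 3) ≤ t) :
    (X n).1 t = (X (n + 1)).1 t := by
  have h' : (1 : ℝ) - (1 / 2) ^ (n + 3) ≤ t := h
  have he := half_pow_pos n
  rw [half_pow_add_three] at h'
  refine Subtype.ext ?_
  rw [coe_X, coe_X, genFun_double he (by linarith), half_pow_succ,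
    genFun_double (by linarith) (by linarith)]

theorem X_mul_X_succ_inv_mem_D (n : ℕ) : X n * (X (n + 1))⁻¹ ∈ D := by
  refine ⟨vertex (n + 2), ⟨?_, vertex_lt_one _⟩, fun x hx => ?_⟩
  · exact lt_of_le_of_lt (unitInterval.nonneg' : 0 ≤ vertex 0)
      (vertex_strictMono (by omega))
  · have hx' : (1 : ℝ) - (1 / 2) ^ (n + 2) ≤ x := hx.1
    have he := half_pow_pos n
    rw [mul_val_apply, X_apply_eq_X_succ_apply, val_apply_inv_val]
    change (1 : ℝ) - (1 / 2) ^ (n + 3) ≤ ((X (n + 1))⁻¹.1 x : ℝ)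
    rw [half_pow_add_two] at hx'
    rw [coe_X_inv, half_pow_add_three, half_pow_succ]
    rw [genInv_half (by linarith) (by linarith)]
    linarith

theorem X_zero_pow_apply_lt (k : ℕ) {t : I} (h : 0 < t) (h' : t < 1) :
    (X 0 ^ (k + 1)).1 t < t := by
  have h0 : ∀ s : I, 0 < s → s < 1 → (X 0).1 s < s := fun s hs hs' =>
    X_apply_lt (vertex_zero ▸ hs) hs'
  induction k with
  | zero => simpa using h0 t h h'
  | succ k ih =>
    rw [pow_succ', mul_val_apply]
    exact (X_apply_le 0 _).trans_lt ih

theorem eq_zero_of_X_zero_zpow_mem_D {k : ℤ} (hk : X 0 ^ k ∈ D) : k = 0 := by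
  have key : ∀ n : ℕ, X 0 ^ (n + 1) ∉ D := by
    rintro n ⟨δ, hδ, h⟩
    exact (X_zero_pow_apply_lt n hδ.1 hδ.2).ne (h δ ⟨le_rfl, hδ.2.le⟩)
  obtain ⟨n, rfl | rfl⟩ := k.eq_nat_or_neg
  · cases n with
    | zero => rfl
    | succ n => exact absurd (by simpa only [zpow_natCast] using hk) (key n)
  · cases n with
    | zero => rfl
    | succ n =>
      refine absurd (inv_mem hk) ?_
      rw [zpow_neg, inv_inv, zpow_natCast]
      exact key n

/-! ### The generators generate -/

/-- `f` maps the interval `[a, a + l]` affinely onto the standard dyadic interval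
`[k / 2 ^ n, (k + 1) / 2 ^ n]`. -/
def MapsStd (f : F) (a l : ℝ) (k n : ℕ) : Prop :=
  ∀ x : I, a ≤ x → x ≤ a + l → (f.1 x : ℝ) = (k + (x - a) / l) * (1 / 2) ^ n

/-- Length of the `i`-th leaf of the subdivision of `[0, 1]` at the points `1 - 2⁻ⁱ`,
`1 ≤ i ≤ M`; its leaves are numbered from `0` to `M`, the last one being `[1 - 2⁻ᴹ, 1]`. -/
noncomputable def leafLength (M i : ℕ) : ℝ := if i < M then (1 / 2) ^ (i + 1) else (1 / 2) ^ i

/-- `f` maps the `i`-th leaf of the subdivision of `[0, 1]` at the points `1 - 2⁻ⁱ`, `1 ≤ i ≤ M`,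
affinely onto `[k / 2 ^ n, (k + 1) / 2 ^ n]`. -/
def LeafStd (M : ℕ) (f : F) (i k n : ℕ) : Prop :=
  MapsStd f (1 - (1 / 2) ^ i) (leafLength M i) k n

theorem leafLength_pos (M i : ℕ) : 0 < leafLength M i := by
  unfold leafLength; split_ifs <;> positivity

theorem leafLength_of_lt {M i : ℕ} (h : i < M) : leafLength M i = (1 / 2) ^ i / 2 := by
  rw [leafLength, if_pos h, half_pow_succ]

theorem leafLength_self (M : ℕ) : leafLength M M = (1 / 2) ^ M := if_neg (lt_irrefl M)

theorem MapsStd.left_half {f : F} {a l : ℝ} {k n : ℕ} (hl : 0 < l) (h : MapsStd f a l k n) :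
    MapsStd f a (l / 2) (2 * k) (n + 1) := by
  intro x hx hx'
  rw [h x hx (by linarith), half_pow_succ]
  push_cast
  field_simp

theorem MapsStd.right_half {f : F} {a l : ℝ} {k n : ℕ} (hl : 0 < l) (h : MapsStd f a l k n) :
    MapsStd f (a + l / 2) (l / 2) (2 * k + 1) (n + 1) := by
  intro x hx hx'
  rw [h x (by linarith) (by linarith), half_pow_succ]
  push_cast
  field_simp
  ring

theorem MapsStd.merge {f : F} {a l : ℝ} {k n : ℕ} (hl : 0 < l)
    (h : MapsStd f a (l / 2) (2 * k) (n + 1))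
    (h' : MapsStd f (a + l / 2) (l / 2) (2 * k + 1) (n + 1)) : MapsStd f a l k n := by
  intro x hx hx'
  rcases le_total (x : ℝ) (a + l / 2) with hm | hm
  · rw [h x hx hm, half_pow_succ]
    push_cast
    field_simp
  · rw [h' x hm (by linarith), half_pow_succ]
    push_cast
    field_simp
    ring

theorem MapsStd.comp {f g : F} {a l b m : ℝ} {k n : ℕ} (hl : 0 < l) (hm : 0 < m)
    (h : MapsStd f b m k n)
    (hg : ∀ x : I, a ≤ x → x ≤ a + l → (g.1 x : ℝ) = b + (x - a) / l * m) :
    MapsStd (f * g) a l k n := by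
  intro x hx hx'
  have h0 : 0 ≤ ((x : ℝ) - a) / l := div_nonneg (by linarith) hl.le
  have h1 : ((x : ℝ) - a) / l ≤ 1 := (div_le_one hl).2 (by linarith)
  have hgx := hg x hx hx'
  rw [mul_val_apply, h (g.1 x) (by rw [hgx]; nlinarith) (by rw [hgx]; nlinarith), hgx,
    add_sub_cancel_left, mul_div_cancel_right₀ _ hm.ne']


theorem MapsStd.congr {f : F} {a l a' l' : ℝ} {k n : ℕ} (h : MapsStd f a l k n) (ha : a = a')
    (hl : l = l') : MapsStd f a' l' k n := ha ▸ hl ▸ h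

theorem leafLength_succ_succ (M i : ℕ) : leafLength (M + 1) (i + 1) = leafLength M i / 2 := by
  unfold leafLength
  simp only [add_lt_add_iff_right]
  split_ifs <;> rw [half_pow_succ]

theorem leafLength_congr {M i : ℕ} (h : i < M) : leafLength (M + 1) i = leafLength M i := by
  rw [leafLength_of_lt h, leafLength_of_lt (by omega)]

theorem vertex_add_leafLength {M i : ℕ} (h : i < M) :
    1 - (1 / 2) ^ i + leafLength M i = 1 - (1 / 2) ^ (i + 1) := by
  rw [leafLength_of_lt h, half_pow_succ]; ring

/-- A leaf whose image is standard can be split: by composing with `X i`, or by refining the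
subdivision if it is the last leaf. -/
theorem exists_split {M N i : ℕ} {f : F}
    (hf : ∀ j ≤ M, ∃ k n, n ≤ N ∧ LeafStd M f j k n) (hi : i ≤ M)
    (hs : ∃ k n, n < N ∧ LeafStd M f i k n) :
    ∃ h ∈ Subgroup.closure (Set.range X), ∀ j ≤ M + 1, ∃ k n, n ≤ N ∧
      LeafStd (M + 1) (f * h) j k n := by
  obtain ⟨q, m, hm, hs⟩ := hs
  have he := half_pow_pos i
  rcases hi.eq_or_lt with rfl | hi
  · refine ⟨1, one_mem _, fun j hj => ?_⟩
    rw [mul_one]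
    have hs' : MapsStd f _ _ q m := hs
    rw [leafLength_self] at hs'
    rcases lt_trichotomy j i with h | rfl | h
    · obtain ⟨k, n, hn, hk⟩ := hf j h.le
      exact ⟨k, n, hn, hk.congr rfl (leafLength_congr h).symm⟩
    · exact ⟨2 * q, m + 1, hm, (hs'.left_half he).congr rfl
        (leafLength_of_lt (Nat.lt_succ_self j)).symm⟩
    · obtain rfl : j = i + 1 := by omega
      refine ⟨2 * q + 1, m + 1, hm, (hs'.right_half he).congr ?_ ?_⟩
      · rw [half_pow_succ]; ring
      · rw [leafLength_self, half_pow_succ]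
  · refine ⟨X i, Subgroup.subset_closure ⟨i, rfl⟩, fun j hj => ?_⟩
    have hs' : MapsStd f _ _ q m := hs
    rw [leafLength_of_lt hi] at hs'
    rcases lt_trichotomy j i with h | rfl | h
    · obtain ⟨k, n, hn, hk⟩ := hf j (by omega)
      refine ⟨k, n, hn, MapsStd.comp (leafLength_pos _ _) (leafLength_pos M j) hk
        fun x hx hx' => ?_⟩
      rw [leafLength_congr (by omega), div_mul_cancel₀ _ (leafLength_pos M j).ne', coe_X,
        genFun_of_le he]
      · ring
      · refine hx'.trans ?_
        rw [vertex_add_leafLength (by omega)]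
        linarith [half_pow_anti (show j + 1 ≤ i from h)]
    · refine ⟨2 * q, m + 1, hm, MapsStd.comp (leafLength_pos _ _) (by positivity)
        (hs'.left_half (by positivity)) fun x hx hx' => ?_⟩
      rw [leafLength_of_lt (by omega)] at hx' ⊢
      rw [coe_X, genFun_half hx (by linarith)]
      field_simp
      ring
    · obtain ⟨j, rfl⟩ : ∃ l, j = l + 1 := ⟨j - 1, by omega⟩
      rcases (show i ≤ j by omega).eq_or_lt with rfl | h
      · refine ⟨2 * q + 1, m + 1, hm, MapsStd.comp (leafLength_pos _ _) (by positivity)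
          (hs'.right_half (by positivity)) fun x hx hx' => ?_⟩
        rw [leafLength_of_lt (by omega), half_pow_succ] at hx'
        rw [half_pow_succ] at hx
        rw [leafLength_of_lt (by omega), half_pow_succ, coe_X,
          genFun_shift he hx (by linarith)]
        field_simp
        ring
      · obtain ⟨k, n, hn, hk⟩ := hf j (by omega)
        refine ⟨k, n, hn, MapsStd.comp (leafLength_pos _ _) (leafLength_pos M j) hk
          fun x hx hx' => ?_⟩
        have hd := half_pow_anti (show i + 1 ≤ j from h)
        rw [half_pow_succ] at hx hd
        have := leafLength_pos M j
        rw [leafLength_succ_succ, half_pow_succ, coe_X, genFun_double he (by linarith)]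
        field_simp
        ring

/-- Two neighbouring leaves with sibling images can be merged into one. -/
theorem exists_merge {M i q m : ℕ} {f : F} (hf : ∀ j ≤ M + 1, ∃ k n, LeafStd (M + 1) f j k n)
    (hi : i ≤ M) (h0 : LeafStd (M + 1) f i (2 * q) (m + 1))
    (h1 : LeafStd (M + 1) f (i + 1) (2 * q + 1) (m + 1)) :
    ∃ h ∈ Subgroup.closure (Set.range X), ∀ j ≤ M, ∃ k n, LeafStd M (f * h) j k n := by
  have he := half_pow_pos i
  have h0' : MapsStd f _ _ _ _ := h0
  have h1' : MapsStd f _ _ _ _ := h1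
  rw [leafLength_of_lt (by omega)] at h0'
  rcases hi.eq_or_lt with rfl | hi
  · refine ⟨1, one_mem _, fun j hj => ?_⟩
    rw [mul_one]
    rcases hj.eq_or_lt with rfl | h
    · refine ⟨q, m, (MapsStd.merge he h0' (h1'.congr ?_ ?_)).congr rfl (leafLength_self j).symm⟩
      · rw [half_pow_succ]; ring
      · rw [leafLength_self, half_pow_succ]
    · obtain ⟨k, n, hk⟩ := hf j (by omega)
      exact ⟨k, n, hk.congr rfl (leafLength_congr h)⟩
  · refine ⟨(X i)⁻¹, inv_mem (Subgroup.subset_closure ⟨i, rfl⟩), fun j hj => ?_⟩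
    rw [leafLength_of_lt (by omega), half_pow_succ] at h1'
    rcases lt_trichotomy j i with h | rfl | h
    · obtain ⟨k, n, hk⟩ := hf j (by omega)
      refine ⟨k, n, MapsStd.comp (leafLength_pos _ _) (leafLength_pos _ _) hk fun x hx hx' => ?_⟩
      rw [leafLength_congr (by omega), div_mul_cancel₀ _ (leafLength_pos M j).ne', coe_X_inv,
        genInv_of_le he]
      · ring
      · refine hx'.trans ?_
        rw [vertex_add_leafLength (by omega)]
        linarith [half_pow_anti (show j + 1 ≤ i from h)]
    · refine ⟨q, m, (MapsStd.merge (l := (1 / 2) ^ j / 2) (by positivity) ?_ ?_).congr rfl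
        (leafLength_of_lt hi).symm⟩
      · refine MapsStd.comp (by positivity) (by positivity) h0' fun x hx hx' => ?_
        rw [coe_X_inv, genInv_double hx (by linarith)]
        field_simp
        ring
      · refine MapsStd.comp (by positivity) (by positivity) h1' fun x hx hx' => ?_
        rw [coe_X_inv, genInv_shift he (by linarith) (by linarith)]
        field_simp
        ring
    · obtain ⟨k, n, hk⟩ := hf (j + 1) (by omega)
      refine ⟨k, n, MapsStd.comp (leafLength_pos _ _) (leafLength_pos _ _) hk
        fun x hx hx' => ?_⟩
      have hd := half_pow_anti (show i + 1 ≤ j from h)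
      rw [half_pow_succ] at hd
      have := leafLength_pos M j
      rw [leafLength_succ_succ, half_pow_succ, coe_X_inv, genInv_half he (by linarith)]
      field_simp
      ring

theorem val_apply_zero (f : F) : f.1 0 = 0 := IsDyadicPL.map_zero f.2

theorem val_apply_one (f : F) : f.1 1 = 1 := by
  obtain ⟨y, hy⟩ := f.1.surjective 1
  refine le_antisymm unitInterval.le_one' ?_
  have h := (IsDyadicPL.strictMono f.2).monotone (unitInterval.le_one' : y ≤ 1)
  rwa [hy] at h

theorem LeafStd.apply_vertex {M j k n : ℕ} {f : F} (h : LeafStd M f j k n) :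
    (f.1 (vertex j) : ℝ) = k * (1 / 2) ^ n := by
  have := h (vertex j) le_rfl (le_add_of_nonneg_right (leafLength_pos M j).le)
  rw [this, show (vertex j : ℝ) = 1 - (1 / 2) ^ j from rfl, sub_self, zero_div, add_zero]

theorem LeafStd.apply_vertex_succ {M j k n : ℕ} {f : F} (h : LeafStd M f j k n) (hj : j < M) :
    (f.1 (vertex (j + 1)) : ℝ) = (k + 1) * (1 / 2) ^ n := by
  have e : (vertex (j + 1) : ℝ) = 1 - (1 / 2) ^ j + leafLength M j :=
    (vertex_add_leafLength hj).symm
  have hl := leafLength_pos M j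
  rw [h (vertex (j + 1)) (by rw [e]; linarith) e.le, e, add_sub_cancel_left, div_self hl.ne']

theorem LeafStd.last {M k n : ℕ} {f : F} (h : LeafStd M f M k n) :
    (k + 1 : ℝ) * (1 / 2) ^ n = 1 := by
  have he := half_pow_pos M
  have := h 1 (by simp) (by rw [leafLength_self]; simp)
  rw [val_apply_one, leafLength_self, Set.Icc.coe_one, sub_sub_cancel, div_self he.ne'] at this
  exact this.symm

theorem mul_half_pow_eq {a b : ℝ} {m n : ℕ} :
    a * (1 / 2) ^ m = b * (1 / 2) ^ n ↔ a * 2 ^ n = b * 2 ^ m := by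
  rw [one_div, inv_pow, inv_pow, ← div_eq_mul_inv, ← div_eq_mul_inv,
    div_eq_div_iff (by positivity) (by positivity)]

theorem odd_mul_two_pow {a b s t : ℕ} (h : (2 * a + 1) * 2 ^ s = b * 2 ^ t) (hst : s ≤ t) :
    s = t ∧ 2 * a + 1 = b := by
  obtain ⟨d, rfl⟩ := Nat.exists_eq_add_of_le hst
  have h' : 2 * a + 1 = b * 2 ^ d := by
    refine Nat.eq_of_mul_eq_mul_right (show 0 < 2 ^ s by positivity) ?_
    rw [h, pow_add]; ring
  cases d with
  | zero => simpa using h'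
  | succ d => rw [pow_succ, ← mul_assoc] at h'; omega

/-- In a subdivision of `[0, 1]` into standard dyadic intervals, an interval of smallest length
has its sibling next to it. -/
theorem exists_siblings {k n : ℕ → ℕ} {M : ℕ} (h0 : k 0 = 0)
    (hs : ∀ j ≤ M, (k j + 1) * 2 ^ n (j + 1) = k (j + 1) * 2 ^ n j)
    (hl : k (M + 1) + 1 = 2 ^ n (M + 1)) :
    ∃ i ≤ M, ∃ q m, k i = 2 * q ∧ n i = m + 1 ∧ k (i + 1) = 2 * q + 1 ∧ n (i + 1) = m + 1 := by
  obtain ⟨i, hi, hmax⟩ := Finset.exists_max_image (Finset.range (M + 2)) n ⟨0, by simp⟩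
  simp only [Finset.mem_range] at hi hmax
  obtain hm | ⟨m, hm⟩ : n i = 0 ∨ ∃ m, n i = m + 1 := by
    cases n i with
    | zero => exact Or.inl rfl
    | succ m => exact Or.inr ⟨m, rfl⟩
  · have a1 : n (M + 1) = 0 := by have := hmax (M + 1) (by omega); omega
    have a2 : n M = 0 := by have := hmax M (by omega); omega
    have := hs M le_rfl
    rw [a1] at this hl
    rw [a2] at this
    omega
  rcases Nat.even_or_odd' (k i) with ⟨q, hq | hq⟩
  · have hiM : i ≤ M := by
      by_contra! h
      obtain rfl : i = M + 1 := by omega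
      rw [hm, pow_succ] at hl
      omega
    have h := hs i hiM
    rw [hq] at h
    obtain ⟨e1, e2⟩ := odd_mul_two_pow h (hmax (i + 1) (by omega))
    exact ⟨i, hiM, q, m, hq, hm, e2.symm, e1.trans hm⟩
  · obtain ⟨i, rfl⟩ : ∃ l, i = l + 1 := ⟨i - 1, by
      have : i ≠ 0 := by rintro rfl; omega
      omega⟩
    have h := hs i (by omega)
    rw [hq] at h
    obtain ⟨e1, e2⟩ := odd_mul_two_pow h.symm (hmax i (by omega))
    exact ⟨i, by omega, q, m, by omega, e1.trans hm, hq, hm⟩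

/-- If the leaves of a subdivision at the points `1 - 2⁻ⁱ` have standard images under `f`, then `f`
is a product of generators: merge leaves until only one is left. -/
theorem mem_closure_of_leafStd (M : ℕ) : ∀ f : F, (∀ j ≤ M, ∃ k n, LeafStd M f j k n) →
    f ∈ Subgroup.closure (Set.range X) := by
  induction M with
  | zero =>
    intro f hf
    obtain ⟨k, n, h⟩ := hf 0 le_rfl
    have h0 := h.apply_vertex
    rw [vertex_zero, val_apply_zero, Set.Icc.coe_zero, eq_comm, mul_eq_zero,
      or_iff_left (half_pow_pos n).ne'] at h0
    have h1 := h.last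
    rw [h0, zero_add, one_mul] at h1
    convert one_mem (Subgroup.closure (Set.range X)) using 1
    refine F_ext fun t => Subtype.ext ?_
    have := h t (by simpa using t.2.1) (by rw [leafLength_self]; simpa using t.2.2)
    rw [this, h0, h1, leafLength_self]
    simp
  | succ M ih =>
    intro f hf
    choose! k n h using hf
    have h0 : k 0 = 0 := by
      have h0 := (h 0 (by omega)).apply_vertex
      rw [vertex_zero, val_apply_zero, Set.Icc.coe_zero, eq_comm, mul_eq_zero,
        or_iff_left (half_pow_pos _).ne'] at h0
      exact_mod_cast h0
    have hs : ∀ j ≤ M, (k j + 1) * 2 ^ n (j + 1) = k (j + 1) * 2 ^ n j := fun j hj => by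
      have e1 := (h j (by omega)).apply_vertex_succ (by omega)
      have e2 := (h (j + 1) (by omega)).apply_vertex
      exact_mod_cast mul_half_pow_eq.1 (e1.symm.trans e2)
    have hl : k (M + 1) + 1 = 2 ^ n (M + 1) := by
      have e := (h (M + 1) le_rfl).last
      rw [one_div, inv_pow, mul_inv_eq_one₀ (by positivity)] at e
      exact_mod_cast e
    obtain ⟨i, hi, q, m, e1, e2, e3, e4⟩ := exists_siblings h0 hs hl
    have a0 := h i (by omega)
    have a1 := h (i + 1) (by omega)
    rw [e1, e2] at a0
    rw [e3, e4] at a1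
    obtain ⟨g, hg, hfg⟩ := exists_merge (fun j hj => ⟨k j, n j, h j hj⟩) hi a0 a1
    have := ih _ hfg
    exact (Subgroup.mul_mem_cancel_right _ hg).1 this

/-- Images of length at least `2⁻ᴺ` bound the number of leaves by `2ᴺ`. -/
theorem succ_le_two_pow_of_leafStd {M N : ℕ} {f : F}
    (hf : ∀ j ≤ M, ∃ k n, n ≤ N ∧ LeafStd M f j k n) : M + 1 ≤ 2 ^ N := by
  have key : ∀ j ≤ M, (j : ℝ) * (1 / 2) ^ N ≤ f.1 (vertex j) := by
    intro j
    induction j with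
    | zero => intro _; simpa using (f.1 (vertex 0)).2.1
    | succ j ih =>
      intro hj
      obtain ⟨k, n, hn, h⟩ := hf j (by omega)
      have h1 := ih (by omega)
      rw [h.apply_vertex] at h1
      rw [h.apply_vertex_succ (by omega)]
      have := half_pow_anti hn
      push_cast
      linarith
  obtain ⟨k, n, hn, h⟩ := hf M le_rfl
  have h1 := key M le_rfl
  rw [h.apply_vertex] at h1
  have h2 := h.last
  have h3 := half_pow_anti hn
  have h4 : ((M : ℝ) + 1) * (1 / 2) ^ N ≤ 1 := by linarith
  rw [one_div, inv_pow, ← div_eq_mul_inv, div_le_one (by positivity)] at h4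
  exact_mod_cast h4

/-- Some product of generators maps a subdivision at the points `1 - 2⁻ⁱ` affinely onto the
subdivision into intervals of length `2⁻ᴺ`. -/
theorem exists_leafStd_level (N : ℕ) : ∃ M, ∃ h ∈ Subgroup.closure (Set.range X),
    ∀ j ≤ M, ∃ k, LeafStd M h j k N := by
  by_contra! hno
  -- otherwise some leaf can always be split further
  have key : ∀ M, ∃ h ∈ Subgroup.closure (Set.range X),
      ∀ j ≤ M, ∃ k n, n ≤ N ∧ LeafStd M h j k n := by
    intro M
    induction M with
    | zero =>
      refine ⟨1, one_mem _, fun j hj => ⟨0, 0, Nat.zero_le _, fun x _ _ => ?_⟩⟩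
      obtain rfl : j = 0 := by omega
      rw [leafLength_self]
      simp
    | succ M ih =>
      obtain ⟨h, hh, hM⟩ := ih
      obtain ⟨i, hi, hi'⟩ := hno M h hh
      obtain ⟨k, n, hn, hk⟩ := hM i hi
      obtain ⟨g, hg, hfg⟩ := exists_split hM hi
        ⟨k, n, lt_of_le_of_ne hn (by rintro rfl; exact hi' k hk), hk⟩
      exact ⟨h * g, mul_mem hh hg, hfg⟩
  obtain ⟨h, -, hM⟩ := key (2 ^ N)
  have := succ_le_two_pow_of_leafStd hM
  omega

theorem IsDyadic.eventually {x : ℝ} (hx : IsDyadic x) :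
    ∀ᶠ N : ℕ in Filter.atTop, ∃ m : ℤ, x = m * (1 / 2) ^ N := by
  obtain ⟨m, n, rfl⟩ := hx
  filter_upwards [Filter.eventually_ge_atTop n] with N hN
  obtain ⟨d, rfl⟩ := Nat.exists_eq_add_of_le hN
  refine ⟨m * 2 ^ d, ?_⟩
  push_cast
  rw [one_div, inv_pow, pow_add]
  field_simp

/-- An element of Thompson's group maps all sufficiently short standard dyadic intervals affinely
onto standard dyadic intervals. -/
theorem exists_mapsStd_level (f : F) :
    ∃ N, ∀ j : ℕ, j < 2 ^ N → ∃ k n, MapsStd f (j * (1 / 2) ^ N) ((1 / 2) ^ N) k n := by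
  obtain ⟨S, hSd, hS⟩ := f.2
  obtain ⟨N₀, hN₀⟩ := ((Filter.eventually_all_finset S).2 fun s hs => (hSd s hs).eventually).exists
  -- on each interval of level `N₀`, `f` is affine with constant term a dyadic rational
  have h1 : ∀ i ∈ Finset.range (2 ^ N₀), ∃ (κ : ℤ) (c : ℝ), IsDyadic c ∧
      ∀ x : I, i * (1 / 2) ^ N₀ ≤ (x : ℝ) → (x : ℝ) ≤ (i + 1) * (1 / 2) ^ N₀ →
        (f.1 x : ℝ) = 2 ^ κ * x + c := by
    intro i hi
    have he := half_pow_pos N₀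
    have hi' : ((i : ℝ) + 1) * (1 / 2) ^ N₀ ≤ 1 := by
      rw [one_div, inv_pow, ← div_eq_mul_inv, div_le_one (by positivity)]
      exact_mod_cast Finset.mem_range.1 hi
    have hi0 : 0 ≤ (i : ℝ) * (1 / 2) ^ N₀ := by positivity
    obtain ⟨κ, c, hc⟩ := hS ⟨i * (1 / 2) ^ N₀, hi0, by linarith⟩
      ⟨(i + 1) * (1 / 2) ^ N₀, by linarith, hi'⟩
      (Subtype.mk_lt_mk.2 (by linarith)) fun s hs hs' => by
        obtain ⟨m, hm⟩ := hN₀ s hs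
        have a1 : (i : ℝ) * (1 / 2) ^ N₀ < s := hs'.1
        have a2 : (s : ℝ) < (i + 1) * (1 / 2) ^ N₀ := hs'.2
        rw [hm] at a1 a2
        have b1 := lt_of_mul_lt_mul_right a1 he.le
        have b2 := lt_of_mul_lt_mul_right a2 he.le
        norm_cast at b1 b2
        omega
    refine ⟨κ, c, ?_, fun x hx hx' => hc x ⟨hx, hx'⟩⟩
    have hd : IsDyadic ((i : ℝ) * (1 / 2) ^ N₀) :=
      ⟨i, N₀, by rw [one_div, inv_pow, ← div_eq_mul_inv]; simp⟩
    have h := hc ⟨i * (1 / 2) ^ N₀, hi0, by linarith⟩ ⟨le_rfl, Subtype.mk_le_mk.2 (by linarith)⟩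
    have h' := (IsDyadicPL.isDyadic_apply f.2 (x := ⟨i * (1 / 2) ^ N₀, hi0, by linarith⟩) hd).sub
      (hd.zpow_mul κ)
    rwa [h, add_sub_cancel_left] at h'
  choose! κ c hcd hc using h1
  have h2 : ∀ i ∈ Finset.range (2 ^ N₀), ∀ᶠ N : ℕ in Filter.atTop,
      ∃ n : ℕ, ((1 : ℝ) / 2) ^ n = 2 ^ κ i * (1 / 2) ^ N ∧ ∃ m : ℤ, c i = m * (1 / 2) ^ n := by
    intro i hi
    obtain ⟨r, hr⟩ := Filter.eventually_atTop.1 (hcd i hi).eventually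
    filter_upwards [Filter.eventually_ge_atTop (r + (κ i).natAbs)] with N hN
    refine ⟨((N : ℤ) - κ i).toNat, ?_, hr _ (by omega)⟩
    rw [one_div, inv_pow, inv_pow, ← zpow_natCast, ← zpow_natCast (2 : ℝ) N, ← zpow_neg,
      ← zpow_neg, ← zpow_add₀ two_ne_zero]
    congr 1
    omega
  -- at a sufficiently large level `N`, standard intervals have standard images
  obtain ⟨N, hN, hN₀N⟩ := (((Filter.eventually_all_finset _).2 h2).and
    (Filter.eventually_ge_atTop N₀)).exists
  obtain ⟨d, rfl⟩ := Nat.exists_eq_add_of_le hN₀N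
  refine ⟨N₀ + d, fun j hj => ?_⟩
  have hi : j / 2 ^ d ∈ Finset.range (2 ^ N₀) := by
    rw [Finset.mem_range, Nat.div_lt_iff_lt_mul (by positivity), ← pow_add]
    exact hj
  obtain ⟨n, hn, m, hm⟩ := hN _ hi
  have hci := hc _ hi
  set i := j / 2 ^ d with hidef
  have hlow : i * 2 ^ d ≤ j := Nat.div_mul_le_self j _
  have hup : j + 1 ≤ (i + 1) * 2 ^ d := Nat.lt_mul_of_div_lt (Nat.lt_succ_self _) (by positivity)
  have he := half_pow_pos (N₀ + d)
  have hconv : ∀ a : ℝ, a * (1 / 2) ^ N₀ = a * 2 ^ d * (1 / 2) ^ (N₀ + d) := fun a => by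
    rw [pow_add, one_div, inv_pow, inv_pow]; field_simp
  have hpos := half_pow_pos n
  have hval : ∀ x : I, (j : ℝ) * (1 / 2) ^ (N₀ + d) ≤ x →
      (x : ℝ) ≤ j * (1 / 2) ^ (N₀ + d) + (1 / 2) ^ (N₀ + d) →
      (f.1 x : ℝ) = ((m + j : ℤ) + (x - j * (1 / 2) ^ (N₀ + d)) / (1 / 2) ^ (N₀ + d)) *
        (1 / 2) ^ n := by
    intro x hx hx'
    rw [hci x, hm, hn]
    · push_cast
      field_simp
      ring
    · refine le_trans ?_ hx
      rw [hconv]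
      exact mul_le_mul_of_nonneg_right (by exact_mod_cast hlow) he.le
    · refine hx'.trans ?_
      rw [hconv, ← add_one_mul]
      exact mul_le_mul_of_nonneg_right (by exact_mod_cast hup) he.le
  have hj' : ((j : ℝ) + 1) * (1 / 2) ^ (N₀ + d) ≤ 1 := by
    rw [one_div, inv_pow, ← div_eq_mul_inv, div_le_one (by positivity)]
    exact_mod_cast hj
  have hnn : 0 ≤ m + (j : ℤ) := by
    obtain ⟨p, hp⟩ : ∃ p : I, (p : ℝ) = j * (1 / 2) ^ (N₀ + d) :=
      ⟨⟨_, by positivity, by linarith⟩, rfl⟩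
    have h := hval p hp.ge (by rw [hp]; linarith)
    rw [hp, sub_self, zero_div, add_zero] at h
    have h' := (f.1 p).2.1
    rw [h] at h'
    exact_mod_cast nonneg_of_mul_nonneg_left h' hpos
  refine ⟨(m + j).toNat, n, fun x hx hx' => ?_⟩
  rw [hval x hx hx']
  congr 2
  exact_mod_cast (Int.toNat_of_nonneg hnn).symm

/-- Thompson's group is generated by the elements `X n`: for `f ∈ F` and a product `h` of generators
that maps a subdivision onto sufficiently short intervals, both `f * h` and `h` have standard images
of leaves. -/
theorem closure_range_X : Subgroup.closure (Set.range X) = ⊤ := by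
  refine eq_top_iff.2 fun f _ => ?_
  obtain ⟨N, hN⟩ := exists_mapsStd_level f
  obtain ⟨M, h, hh, hM⟩ := exists_leafStd_level N
  refine (Subgroup.mul_mem_cancel_right _ hh).1 (mem_closure_of_leafStd M _ fun j hj => ?_)
  obtain ⟨k, hk⟩ := hM j hj
  have hk' : k < 2 ^ N := by
    have h1 : ((k : ℝ) + 1) * (1 / 2) ^ N ≤ 1 := by
      rcases hj.eq_or_lt with rfl | hj
      · exact hk.last.le
      · rw [← hk.apply_vertex_succ hj]
        exact (h.1 _).2.2
    rw [one_div, inv_pow, ← div_eq_mul_inv, div_le_one (by positivity)] at h1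
    exact_mod_cast h1
  obtain ⟨k', n', hkn⟩ := hN k hk'
  refine ⟨k', n', hkn.comp (leafLength_pos M j) (half_pow_pos N) fun x hx hx' => ?_⟩
  rw [hk x hx hx', add_mul]

/-! ### Groups satisfying the relations of Thompson's group -/

section abstract

variable {T : Type*} [Group T] {x : ℕ → T}

/-- A nonempty positive word can be rewritten, without changing its length, so that a letter of
smallest index comes first. -/
theorem exists_least_letter (hx : ∀ i j, i < j → x j * x i = x i * x (j + 1)) (k : ℕ)
    (L : List ℕ) : ∃ (i : ℕ) (M : List ℕ), M.length = L.length ∧ (∀ m ∈ M, i ≤ m) ∧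
      ((k :: L).map x).prod = ((i :: M).map x).prod := by
  induction L generalizing k with
  | nil => exact ⟨k, [], rfl, by simp, rfl⟩
  | cons l L ih =>
    obtain ⟨i, M, hlen, hM, h⟩ := ih l
    rcases le_or_gt k i with hk | hk
    · refine ⟨k, i :: M, by simp [hlen], ?_, ?_⟩
      · simpa [hk] using fun m hm => hk.trans (hM m hm)
      · rw [List.map_cons, List.prod_cons, h, ← List.prod_cons, ← List.map_cons]
    · refine ⟨i, (k + 1) :: M, by simp [hlen], ?_, ?_⟩
      · simpa using ⟨by omega, hM⟩
      · rw [List.map_cons, List.prod_cons, h]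
        simp only [List.map_cons, List.prod_cons]
        rw [← mul_assoc, hx i k hk, mul_assoc]

/-- The Ore condition: an inverse generator can be moved to the right of a positive word. -/
theorem exists_inv_mul_word (hx : ∀ i j, i < j → x j * x i = x i * x (j + 1)) (L : List ℕ) :
    ∀ i, ∃ M N : List ℕ, (x i)⁻¹ * (L.map x).prod = (M.map x).prod * ((N.map x).prod)⁻¹ := by
  induction L with
  | nil => exact fun i => ⟨[], [i], by simp⟩
  | cons k L ih =>
    intro i
    rcases lt_trichotomy i k with h | rfl | h
    · obtain ⟨M, N, hMN⟩ := ih i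
      refine ⟨(k + 1) :: M, N, ?_⟩
      simp only [List.map_cons, List.prod_cons]
      rw [mul_assoc, ← hMN, inv_mul_eq_iff_eq_mul]
      simp only [← mul_assoc]
      rw [← hx i k h]
      group
    · exact ⟨L, [], by simp⟩
    · obtain ⟨M, N, hMN⟩ := ih (i + 1)
      refine ⟨k :: M, N, ?_⟩
      simp only [List.map_cons, List.prod_cons]
      rw [mul_assoc, ← hMN, inv_mul_eq_iff_eq_mul]
      simp only [← mul_assoc]
      rw [hx k i h]
      group

theorem exists_word_mul_inv_word (hx : ∀ i j, i < j → x j * x i = x i * x (j + 1))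
    (hgen : Subgroup.closure (Set.range x) = ⊤) (t : T) :
    ∃ M N : List ℕ, t = (M.map x).prod * ((N.map x).prod)⁻¹ := by
  have ht : t ∈ Subgroup.closure (Set.range x) := hgen ▸ Subgroup.mem_top t
  induction ht using Subgroup.closure_induction_left with
  | one => exact ⟨[], [], by simp⟩
  | mul_left a ha b _ ih =>
    obtain ⟨i, rfl⟩ := ha
    obtain ⟨M, N, rfl⟩ := ih
    exact ⟨i :: M, N, by simp [mul_assoc]⟩
  | inv_mul_cancel a ha b _ ih =>
    obtain ⟨i, rfl⟩ := ha
    obtain ⟨M, N, rfl⟩ := ih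
    obtain ⟨M', N', h⟩ := exists_inv_mul_word hx M i
    refine ⟨M', N ++ N', ?_⟩
    rw [← mul_assoc, h]
    simp [mul_assoc]

theorem word_apply_of_le {n : ℕ} {L : List ℕ} (hL : ∀ m ∈ L, n ≤ m) {t : I}
    (ht : t ≤ vertex n) : ((L.map X).prod).1 t = t := by
  induction L with
  | nil => rfl
  | cons k L ih =>
    rw [List.map_cons, List.prod_cons, mul_val_apply, ih fun m hm => hL m (by simp [hm])]
    exact X_apply_of_le (ht.trans (vertex_strictMono.monotone (hL k (by simp))))

theorem word_apply_le (L : List ℕ) (t : I) : ((L.map X).prod).1 t ≤ t := by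
  induction L with
  | nil => exact le_rfl
  | cons k L ih =>
    rw [List.map_cons, List.prod_cons, mul_val_apply]
    exact (X_apply_le k _).trans ih

theorem word_apply_lt (i : ℕ) (L : List ℕ) {t : I} (h : vertex i < t) (h' : t < 1) :
    (((i :: L).map X).prod).1 t < t := by
  rw [List.map_cons, List.prod_cons, mul_val_apply]
  rcases lt_or_ge (vertex i) (((L.map X).prod).1 t) with h1 | h1
  · exact (X_apply_lt h1 ((word_apply_le L t).trans_lt h')).trans_le (word_apply_le L t)
  · exact (X_apply_le i _).trans_lt (h1.trans_lt h)

/-- The smallest index of a positive word is determined by the homeomorphism: it tells where the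
fixed initial interval ends. -/
theorem le_of_word_eq {i j : ℕ} {L M : List ℕ} (hM : ∀ m ∈ M, j ≤ m)
    (h : ((i :: L).map X).prod = ((j :: M).map X).prod) : j ≤ i := by
  by_contra! hij
  have h1 := word_apply_lt i L (vertex_strictMono hij) (vertex_lt_one j)
  rw [h, word_apply_of_le (n := j) (by simpa using hM) le_rfl] at h1
  exact lt_irrefl _ h1

/-- Positive words with the same image in Thompson's group are equal: split off letters of
smallest index, which agree on both sides. -/
theorem word_eq_of_X_word_eq (hx : ∀ i j, i < j → x j * x i = x i * x (j + 1)) (n : ℕ) :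
    ∀ L M : List ℕ, L.length = n → (L.map X).prod = (M.map X).prod →
      (L.map x).prod = (M.map x).prod := by
  have hX : ∀ i j, i < j → X j * X i = X i * X (j + 1) := fun i j h => X_mul_X h
  -- rewriting words in the pairs `(X i, x i)` changes the words in `X` and in `x` in the same way
  have hp : ∀ i j, i < j → (fun i => (X i, x i)) j * (fun i => (X i, x i)) i =
      (fun i => (X i, x i)) i * (fun i => (X i, x i)) (j + 1) :=
    fun i j h => Prod.ext (hX i j h) (hx i j h)
  have hfst : ∀ L : List ℕ, ((L.map fun i => (X i, x i)).prod).1 = (L.map X).prod := fun L => by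
    induction L with
    | nil => rfl
    | cons k L ih => simp only [List.map_cons, List.prod_cons, Prod.fst_mul, ih]
  have hsnd : ∀ L : List ℕ, ((L.map fun i => (X i, x i)).prod).2 = (L.map x).prod := fun L => by
    induction L with
    | nil => rfl
    | cons k L ih => simp only [List.map_cons, List.prod_cons, Prod.snd_mul, ih]
  have hne : ∀ i L, ((i :: L).map X).prod ≠ 1 := fun i L h => by
    have h1 := word_apply_lt i L (vertex_strictMono (Nat.lt_succ_self i)) (vertex_lt_one _)
    rw [h] at h1
    exact lt_irrefl _ h1
  induction n with
  | zero =>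
    intro L M hL h
    rw [List.length_eq_zero_iff] at hL
    subst hL
    cases M with
    | nil => rfl
    | cons k M => exact absurd h.symm (hne k M)
  | succ n ih =>
    intro L M hL h
    cases L with
    | nil => simp at hL
    | cons k L =>
      cases M with
      | nil => exact absurd h (hne k L)
      | cons l M =>
        obtain ⟨i, L', hlen, hL', hLeq⟩ := exists_least_letter hp k L
        obtain ⟨j, M', -, hM', hMeq⟩ := exists_least_letter hp l M
        have e1 := congrArg Prod.fst hLeq
        have e2 := congrArg Prod.snd hLeq
        have e3 := congrArg Prod.fst hMeq
        have e4 := congrArg Prod.snd hMeq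
        rw [hfst, hfst] at e1 e3
        rw [hsnd, hsnd] at e2 e4
        rw [e1, e3] at h
        obtain rfl : i = j := le_antisymm (le_of_word_eq hL' h.symm) (le_of_word_eq hM' h)
        rw [e2, e4, List.map_cons, List.map_cons, List.prod_cons, List.prod_cons]
        rw [List.map_cons, List.map_cons, List.prod_cons, List.prod_cons, mul_right_inj] at h
        rw [ih L' M' (by simp at hL; omega) h]

/-- A group generated by elements satisfying the relations of the `X n` is no larger than the
group they generate. -/
theorem injective_of_map_eq_X (hx : ∀ i j, i < j → x j * x i = x i * x (j + 1))
    (hgen : Subgroup.closure (Set.range x) = ⊤) (φ : T →* F) (hφ : ∀ i, φ (x i) = X i) :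
    Function.Injective φ := by
  rw [injective_iff_map_eq_one]
  intro t ht
  obtain ⟨M, N, rfl⟩ := exists_word_mul_inv_word hx hgen t
  have hw : ∀ L : List ℕ, φ (L.map x).prod = (L.map X).prod := fun L => by
    rw [map_list_prod, List.map_map]
    exact congrArg List.prod (List.map_congr_left fun i _ => hφ i)
  rw [map_mul, map_inv, hw, hw, mul_inv_eq_one] at ht
  rw [word_eq_of_X_word_eq hx _ M N rfl ht, mul_inv_cancel]

/-- The infinitely many relations follow from two of them: if `x (k + 1)` is the conjugate of
`x k` by `x 0` for `k ≥ 1`, it suffices that `x 1` conjugates `x 2` to `x 3` and `x 3` to `x 4`. -/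
theorem relations_of_two (h0 : ∀ k, 1 ≤ k → x k * x 0 = x 0 * x (k + 1))
    (h2 : x 2 * x 1 = x 1 * x 3) (h3 : x 3 * x 1 = x 1 * x 4) (i j : ℕ) (hij : i < j) :
    x j * x i = x i * x (j + 1) := by
  -- conjugation by `x 0` shifts a relation between generators of positive index
  have shift : ∀ m i j, 1 ≤ i → 1 ≤ j → x j * x i = x i * x (j + 1) →
      x (j + m) * x (i + m) = x (i + m) * x (j + m + 1) := by
    intro m
    induction m with
    | zero => exact fun i j _ _ h => h
    | succ m ih =>
      intro i j hi hj h
      have h' := ih i j hi hj h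
      have e : ∀ k, 1 ≤ k → x (k + 1) = (x 0)⁻¹ * x k * x 0 := fun k hk => by
        rw [mul_assoc, h0 k hk, inv_mul_cancel_left]
      rw [← add_assoc, ← add_assoc, e _ (by omega : 1 ≤ j + m), e _ (by omega : 1 ≤ i + m),
        e _ (by omega : 1 ≤ j + m + 1)]
      calc _ = (x 0)⁻¹ * (x (j + m) * x (i + m)) * x 0 := by group
        _ = _ := by rw [h']; group
  -- the relation for `x (k + 4)` and `x 1`: write `x (k + 4)` as the conjugate of `x (k + 3)` by
  -- `x 2`, move `x 1` across, and use the relation for `x (k + 2)`, shifted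
  have h1 : ∀ k, x (k + 2) * x 1 = x 1 * x (k + 3) := by
    intro k
    induction k using Nat.strong_induction_on with
    | _ k ih =>
      match k with
      | 0 => exact h2
      | 1 => exact h3
      | k + 2 =>
        have a1 := ih k (by omega)
        have a2 := ih (k + 1) (by omega)
        have b1 := shift 1 1 (k + 2) le_rfl (by omega) a1
        have b2 := shift 2 1 (k + 2) le_rfl (by omega) a1
        have e4 : x (k + 4) = (x 2)⁻¹ * x (k + 3) * x 2 := by
          rw [mul_assoc, b1, inv_mul_cancel_left]
        have e5 : x (k + 5) = (x 3)⁻¹ * x (k + 4) * x 3 := by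
          rw [mul_assoc, b2, inv_mul_cancel_left]
        have c1 : x 2 * x 1 = x 1 * x 3 := h2
        have c2 : (x 2)⁻¹ * x 1 = x 1 * (x 3)⁻¹ := by
          rw [inv_mul_eq_iff_eq_mul, ← mul_assoc, c1, mul_inv_cancel_right]
        calc x (k + 4) * x 1 = (x 2)⁻¹ * x (k + 3) * x 2 * x 1 := by rw [e4]
          _ = (x 2)⁻¹ * (x (k + 3) * x 1) * x 3 := by
            rw [mul_assoc, c1]; simp only [mul_assoc]
          _ = ((x 2)⁻¹ * x 1) * x (k + 4) * x 3 := by rw [a2]; simp only [mul_assoc]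
          _ = x 1 * x (k + 5) := by rw [c2, e5]; simp only [mul_assoc]
  match i, j, hij with
  | 0, j, hij => exact h0 j hij
  | i + 1, j, hij =>
    obtain ⟨k, rfl⟩ : ∃ k, j = k + 2 + i := ⟨j - i - 2, by omega⟩
    have := shift i 1 (k + 2) le_rfl (by omega) (h1 k)
    rwa [add_comm 1 i] at this

/-- Partial products `x i = g i * g (i + 1) * ⋯ * g n` satisfy the relations of Thompson's group
in the range where these make sense. -/
theorem partial_product_relations {g : ℕ → T} {n : ℕ} (hx : ∀ i ≤ n, x i = g i * x (i + 1))
    (hx1 : ∀ i, n < i → x i = 1)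
    (hb : ∀ i, i + 2 ≤ n → g i * g (i + 1) * g (i + 2) = g (i + 1) * g (i + 2) * g i * g (i + 1))
    (hc : ∀ i j, i + 2 ≤ j → j ≤ n → Commute (g i) (g j)) (i j : ℕ) (hij : i < j) (hj : j < n) :
    x j * x i = x i * x (j + 1) := by
  have hcx : ∀ d i j, n + 1 - j = d → i + 2 ≤ j → Commute (g i) (x j) := by
    intro d
    induction d with
    | zero => intro i j hd _; rw [hx1 j (by omega)]; exact Commute.one_right _
    | succ d ih =>
      intro i j hd hij
      rw [hx j (by omega)]
      exact (hc i j hij (by omega)).mul_right (ih i (j + 1) (by omega) (by omega))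
  obtain ⟨d, rfl⟩ : ∃ d, j = i + 1 + d := ⟨j - i - 1, by omega⟩
  induction d generalizing i with
  | zero =>
    have e0 := hx i (by omega)
    have e1 := hx (i + 1) (by omega)
    have e2 := hx (i + 2) (by omega)
    have c0 : Commute (g i) (x (i + 3)) := hcx _ i _ rfl (by omega)
    have c1 : Commute (g (i + 1)) (x (i + 3)) := hcx _ (i + 1) _ rfl (by omega)
    have b := hb i (by omega)
    rw [add_zero]
    change x (i + 1) * x i = x i * x (i + 2)
    rw [e0, e1, e2]
    change g (i + 1) * (g (i + 2) * x (i + 3)) * (g i * (g (i + 1) * (g (i + 2) * x (i + 3)))) =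
      g i * (g (i + 1) * (g (i + 2) * x (i + 3))) * (g (i + 2) * x (i + 3))
    calc _ = g (i + 1) * g (i + 2) * (x (i + 3) * g i * g (i + 1)) * (g (i + 2) * x (i + 3)) := by
          simp only [mul_assoc]
      _ = (g (i + 1) * g (i + 2) * g i * g (i + 1)) * x (i + 3) * (g (i + 2) * x (i + 3)) := by
          rw [← c0.eq, mul_assoc (g i), ← c1.eq]; simp only [mul_assoc]
      _ = _ := by rw [← b]; simp only [mul_assoc]
  | succ d ih =>
    have c : Commute (g i) (x (i + 1 + (d + 1))) := hcx _ i _ rfl (by omega)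
    have h := ih (i + 1) (by omega) (by omega)
    rw [show i + 1 + 1 + d = i + 1 + (d + 1) by omega] at h
    rw [hx i (by omega), ← mul_assoc, ← c.eq, mul_assoc, h, mul_assoc]

end abstract

/-! ### The groups `G J` -/

section presentation

variable {T : Type*} [Group T] {J : Set ℤ} {g : ℤ → T}

/-- The elements `g i`, for `i ∈ J`, satisfy the defining relations of the group `G J`. The values
of `g` outside `J` are irrelevant. -/
structure Satisfies (J : Set ℤ) (g : ℤ → T) : Prop where
  triple : ∀ i, i - 1 ∈ J → i ∈ J → i + 1 ∈ J →
    g (i - 1) * g i * g (i + 1) = g i * g (i + 1) * g (i - 1) * g i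
  comm : ∀ i ∈ J, ∀ j ∈ J, i + 2 ≤ j → Commute (g i) (g j)

theorem Satisfies.mono {J' : Set ℤ} (h : Satisfies J' g) (hJ : J ⊆ J') : Satisfies J g :=
  ⟨fun i h0 h1 h2 => h.triple i (hJ h0) (hJ h1) (hJ h2),
    fun i hi j hj => h.comm i (hJ hi) j (hJ hj)⟩

theorem Satisfies.shift (h : Satisfies Set.univ g) (c : ℤ) :
    Satisfies Set.univ fun i => g (i + c) := by
  refine ⟨fun i _ _ _ => ?_, fun i _ j _ hij => h.comm _ trivial _ trivial (by omega)⟩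
  have := h.triple (i + c) trivial trivial trivial
  rwa [show i + c - 1 = i - 1 + c by ring, show i + c + 1 = i + 1 + c by ring] at this

theorem Satisfies.relators_eq_one (h : Satisfies J g) :
    ∀ r ∈ relators J, FreeGroup.lift (fun i : J => g i) r = 1 := by
  rintro r (⟨a, b, c, hab, hcb, rfl⟩ | ⟨i, j, hij, rfl⟩)
  · simp only [map_mul, map_inv, FreeGroup.lift_apply_of]
    rw [mul_inv_eq_one, hab, hcb]
    exact h.triple b (hab ▸ a.2) b.2 (hcb ▸ c.2)
  · simp only [map_mul, map_inv, FreeGroup.lift_apply_of]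
    rw [mul_inv_eq_one, mul_inv_eq_iff_eq_mul]
    rcases le_abs.1 hij with hij | hij
    · exact (h.comm j j.2 i i.2 (by omega)).eq.symm
    · exact (h.comm i i.2 j j.2 (by omega)).eq

/-- The universal property of `G J`. -/
noncomputable def Satisfies.lift (h : Satisfies J g) : G J →* T :=
  PresentedGroup.toGroup h.relators_eq_one

open Classical in
/-- The generators of `G J`, as a family indexed by all integers: `gen J i = 1` for `i ∉ J`. -/
noncomputable def gen (J : Set ℤ) (i : ℤ) : G J :=
  if h : i ∈ J then PresentedGroup.of ⟨i, h⟩ else 1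

theorem Satisfies.lift_gen (h : Satisfies J g) {i : ℤ} (hi : i ∈ J) : h.lift (gen J i) = g i := by
  rw [gen, dif_pos hi]
  exact PresentedGroup.toGroup.of _

theorem satisfies_gen (J : Set ℤ) : Satisfies J (gen J) := by
  refine ⟨fun i h0 h1 h2 => ?_, fun i hi j hj hij => ?_⟩
  · rw [gen, gen, gen, dif_pos h0, dif_pos h1, dif_pos h2, ← mul_inv_eq_one]
    exact PresentedGroup.one_of_mem (Or.inl ⟨⟨_, h0⟩, ⟨_, h1⟩, ⟨_, h2⟩, rfl, rfl, rfl⟩)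
  · rw [gen, gen, dif_pos hi, dif_pos hj]
    have : (PresentedGroup.of ⟨i, hi⟩ * PresentedGroup.of ⟨j, hj⟩ * (PresentedGroup.of ⟨i, hi⟩)⁻¹ *
        (PresentedGroup.of ⟨j, hj⟩)⁻¹ : G J) = 1 :=
      PresentedGroup.one_of_mem (Or.inr ⟨⟨i, hi⟩, ⟨j, hj⟩, by
        rw [abs_sub_comm]; exact le_abs.2 (Or.inl (by simp; omega)), rfl⟩)
    rwa [mul_inv_eq_one, mul_inv_eq_iff_eq_mul] at this

theorem closure_gen (J : Set ℤ) : Subgroup.closure (gen J '' J) = ⊤ := by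
  rw [eq_top_iff, ← PresentedGroup.closure_range_of, Subgroup.closure_le]
  rintro _ ⟨i, rfl⟩
  refine Subgroup.subset_closure ⟨i, i.2, ?_⟩
  rw [gen, dif_pos i.2]

theorem hom_ext_gen {φ ψ : G J →* T} (h : ∀ i ∈ J, φ (gen J i) = ψ (gen J i)) : φ = ψ := by
  refine MonoidHom.eq_of_eqOn_dense (closure_gen J) ?_
  rintro _ ⟨i, hi, rfl⟩
  exact h i hi

theorem Satisfies.range_lift (h : Satisfies J g) : h.lift.range = Subgroup.closure (g '' J) := by
  rw [MonoidHom.range_eq_map, ← closure_gen, MonoidHom.map_closure, Set.image_image]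
  congr 1
  exact Set.image_congr fun i hi => h.lift_gen hi

/-- If two actions of `G J` on the unit interval are intertwined by an injective map, then every
element acting trivially in the first one acts trivially in the second one. -/
theorem eq_one_of_intertwine {φ ψ : G J →* F} {θ : I → I} (hθ : Function.Injective θ)
    (h : ∀ i ∈ J, ∀ t, (φ (gen J i)).1 (θ t) = θ ((ψ (gen J i)).1 t)) {w : G J} (hw : φ w = 1) :
    ψ w = 1 := by
  have key : ∀ w : G J, ∀ t, (φ w).1 (θ t) = θ ((ψ w).1 t) := by
    intro w
    have hw : w ∈ Subgroup.closure (gen J '' J) := closure_gen J ▸ Subgroup.mem_top w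
    induction hw using Subgroup.closure_induction with
    | mem x hx => obtain ⟨i, hi, rfl⟩ := hx; exact h i hi
    | one => intro t; rw [map_one, map_one]; rfl
    | mul a b _ _ ha hb =>
      intro t
      rw [map_mul, map_mul, mul_val_apply, mul_val_apply, hb, ha]
    | inv a _ ha =>
      intro t
      rw [map_inv, map_inv]
      conv_lhs => rw [← val_apply_inv_val (ψ a) t, ← ha, inv_val_apply_val]
  refine F_ext fun t => hθ ?_
  rw [← key w t, hw]
  rfl

end presentation

/-! ### Elements with small support -/

/-- The element `X i * (X (i + 1))⁻¹`, which is supported on `[1 - 2⁻ⁱ, 1 - 2⁻ⁱ⁻²]`. -/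
noncomputable def bump (i : ℕ) : F := X i * (X (i + 1))⁻¹

theorem X_eq_bump_mul (i : ℕ) : X i = bump i * X (i + 1) := (inv_mul_cancel_right _ _).symm

theorem X_inv_mul_X {i j : ℕ} (h : i < j) : (X i)⁻¹ * X j = X (j + 1) * (X i)⁻¹ := by
  rw [inv_mul_eq_iff_eq_mul, ← mul_assoc, ← X_mul_X h, mul_inv_cancel_right]

theorem X_inv_mul_X_of_gt {i j : ℕ} (h : i < j) : (X j)⁻¹ * X i = X i * (X (j + 1))⁻¹ := by
  rw [inv_mul_eq_iff_eq_mul, ← mul_assoc, X_mul_X h, mul_inv_cancel_right]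

theorem commute_bump_X {i j : ℕ} (h : i + 2 ≤ j) : Commute (bump i) (X j) := by
  change X i * (X (i + 1))⁻¹ * X j = X j * (X i * (X (i + 1))⁻¹)
  rw [mul_assoc, X_inv_mul_X (by omega), ← mul_assoc, ← X_mul_X (by omega), mul_assoc]

theorem commute_bump_bump {i j : ℕ} (h : i + 2 ≤ j) : Commute (bump i) (bump j) :=
  (commute_bump_X h).mul_right (commute_bump_X (by omega)).inv_right

theorem bump_mul_bump_mul_X (i : ℕ) :
    bump i * bump (i + 1) * X (i + 2) = bump (i + 1) * X (i + 2) * bump i * bump (i + 1) := by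
  have h := X_mul_X (show i < i + 1 by omega)
  have e : X i = X (i + 1) * X i * (X (i + 2))⁻¹ := by rw [h, mul_inv_cancel_right]
  simp only [bump]
  calc _ = X i := by group
    _ = X (i + 1) * X i * (X (i + 2))⁻¹ := e
    _ = _ := by group

theorem bump_triple (i : ℕ) :
    bump i * bump (i + 1) * bump (i + 2) = bump (i + 1) * bump (i + 2) * bump i * bump (i + 1) := by
  have h := bump_mul_bump_mul_X i
  have c0 : Commute (bump i) (X (i + 3)) := commute_bump_X (by omega)
  have c1 : Commute (bump (i + 1)) (X (i + 3)) := commute_bump_X (by omega)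
  have e : bump (i + 2) = X (i + 2) * (X (i + 3))⁻¹ := rfl
  calc _ = bump i * bump (i + 1) * X (i + 2) * (X (i + 3))⁻¹ := by rw [e, ← mul_assoc]
    _ = bump (i + 1) * X (i + 2) * (bump i * bump (i + 1) * (X (i + 3))⁻¹) := by
      rw [h]; simp only [mul_assoc]
    _ = bump (i + 1) * X (i + 2) * ((X (i + 3))⁻¹ * (bump i * bump (i + 1))) := by
      rw [((c0.mul_left c1).inv_right).eq]
    _ = _ := by rw [e]; simp only [mul_assoc]

theorem X_inv_conj_bump_of_lt {i j : ℕ} (h : j < i) : (X j)⁻¹ * bump i * X j = bump (i + 1) := by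
  have h1 := X_inv_mul_X h
  have h2 := X_inv_mul_X (show j < i + 1 by omega)
  rw [bump, bump, ← mul_assoc, h1, mul_assoc, mul_assoc, X_inv_mul_X_of_gt (by omega),
    inv_mul_cancel_left]

theorem X_inv_conj_bump_self (i : ℕ) : (X i)⁻¹ * bump i * X i = bump i * bump (i + 1) := by
  have := X_inv_mul_X_of_gt (show i < i + 1 by omega)
  rw [bump, bump, inv_mul_cancel_left, this]
  group

theorem X_succ_inv_conj_bump (i : ℕ) :
    (X (i + 1))⁻¹ * bump i * X (i + 1) = bump i * bump (i + 1) := by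
  have := X_inv_mul_X_of_gt (show i < i + 1 by omega)
  rw [bump, bump, ← mul_assoc, this]
  group

theorem satisfies_bump : Satisfies (Set.Ici 0) fun i : ℤ => bump i.toNat := by
  refine ⟨fun i h0 _ _ => ?_, fun i hi j _ hij => ?_⟩
  · obtain ⟨k, rfl⟩ : ∃ k : ℕ, i = k + 1 := ⟨(i - 1).toNat, by simp at h0; omega⟩
    rw [show ((k : ℤ) + 1 - 1).toNat = k by omega, show ((k : ℤ) + 1).toNat = k + 1 by omega,
      show ((k : ℤ) + 1 + 1).toNat = k + 2 by omega]
    exact bump_triple k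
  · rw [Set.mem_Ici] at hi
    exact commute_bump_bump (by omega)

/-- An element normalizes a subgroup if it and its inverse conjugate a generating set into the
subgroup. -/
theorem mem_closure_iff_conj_mem {T : Type*} [Group T] {S : Set T} {x : T}
    (h : ∀ s ∈ S, x * s * x⁻¹ ∈ Subgroup.closure S)
    (h' : ∀ s ∈ S, x⁻¹ * s * x ∈ Subgroup.closure S) :
    ∀ k, k ∈ Subgroup.closure S ↔ x * k * x⁻¹ ∈ Subgroup.closure S := by
  have key : ∀ y : T, (∀ s ∈ S, y * s * y⁻¹ ∈ Subgroup.closure S) → ∀ k ∈ Subgroup.closure S,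
      y * k * y⁻¹ ∈ Subgroup.closure S := fun y hy k hk => by
    have : Subgroup.closure S ≤ (Subgroup.closure S).comap (MulAut.conj y).toMonoidHom :=
      (Subgroup.closure_le _).2 hy
    exact this hk
  refine fun k => ⟨key x h k, fun hk => ?_⟩
  have := key x⁻¹ (by simpa using h') _ hk
  simpa [mul_assoc] using this

/-- If a subgroup contains `bump i` for all `i ≥ j`, conjugation by `X j` maps an element of it that
commutes with almost all generators back into it, since
`X j = bump j * bump (j + 1) * ⋯ * bump (k - 1) * X k` for all `k ≥ j`. -/
theorem X_conj_mem {K : Subgroup F} {j : ℕ} (hK : ∀ i, j ≤ i → bump i ∈ K) {c : F} (hc : c ∈ K)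
    {m : ℕ} (hm : ∀ k, m ≤ k → Commute c (X k)) : X j * c * (X j)⁻¹ ∈ K := by
  have key : ∀ d i, j ≤ i → m ≤ i + d → X i * c * (X i)⁻¹ ∈ K := by
    intro d
    induction d with
    | zero =>
      intro i _ hi
      rwa [← (hm i hi).eq, mul_inv_cancel_right]
    | succ d ih =>
      intro i hi hd
      have h1 := ih (i + 1) (by omega) (by omega)
      have h2 := mul_mem (mul_mem (hK i hi) h1) (inv_mem (hK i hi))
      convert h2 using 1
      rw [X_eq_bump_mul i]
      group
  exact key m j le_rfl (by omega)

/-- A subgroup of Thompson's group is normal if conjugation by generators preserves it. -/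
theorem normal_of_X {K : Subgroup F} (h : ∀ j k, k ∈ K ↔ X j * k * (X j)⁻¹ ∈ K) : K.Normal := by
  rw [← Subgroup.normalizer_eq_top_iff, eq_top_iff, ← closure_range_X, Subgroup.closure_le]
  rintro _ ⟨j, rfl⟩
  exact Subgroup.mem_normalizer_iff.2 (h j)

/-! ### Finitely many generators: the whole group -/

/-- The generators of `F` that correspond to the generators of `G {0, …, n}`. -/
noncomputable def bumpEnd (n : ℕ) (i : ℤ) : F := if i < n then bump i.toNat else X i.toNat

theorem satisfies_bumpEnd (n : ℕ) : Satisfies (Set.Icc (0 : ℤ) n) (bumpEnd n) := by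
  refine ⟨fun i h0 _ h2 => ?_, fun i hi j hj hij => ?_⟩
  · obtain ⟨k, rfl⟩ : ∃ k : ℕ, i = k + 1 := ⟨(i - 1).toNat, by simp at h0; omega⟩
    rw [Set.mem_Icc] at h2
    rw [bumpEnd, bumpEnd, bumpEnd, if_pos (by omega), if_pos (by omega),
      show ((k : ℤ) + 1 - 1).toNat = k by omega, show ((k : ℤ) + 1).toNat = k + 1 by omega,
      show ((k : ℤ) + 1 + 1).toNat = k + 2 by omega]
    split_ifs
    · exact bump_triple k
    · exact bump_mul_bump_mul_X k
  · rw [Set.mem_Icc] at hi hj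
    rw [bumpEnd, bumpEnd, if_pos (by omega)]
    split_ifs
    · exact commute_bump_bump (by omega)
    · exact commute_bump_X (by omega)

/-- The partial products of the generators of `G {0, …, n}` extend to an infinite sequence of
generators that satisfy the relations of Thompson's group. -/
theorem exists_sequence_of_four_le {n : ℕ} (hn : 4 ≤ n) : ∃ x : ℕ → G (Set.Icc (0 : ℤ) n),
    (∀ i j, i < j → x j * x i = x i * x (j + 1)) ∧ Subgroup.closure (Set.range x) = ⊤ ∧
      ∀ k, (satisfies_bumpEnd n).lift (x k) = X k := by
  set φ := (satisfies_bumpEnd n).lift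
  have hgen := satisfies_gen (Set.Icc (0 : ℤ) n)
  let g : ℕ → G (Set.Icc (0 : ℤ) n) := fun i => gen _ i
  let z : ℕ → G (Set.Icc (0 : ℤ) n) := Nat.rec 1 fun d p => g (n - d) * p
  let y : ℕ → G (Set.Icc (0 : ℤ) n) := fun i => z (n + 1 - i)
  have hy : ∀ i ≤ n, y i = g i * y (i + 1) := fun i hi => by
    change z (n + 1 - i) = g i * z (n + 1 - (i + 1))
    rw [show n + 1 - i = n - i + 1 by omega, show n + 1 - (i + 1) = n - i by omega]
    change g (n - (n - i)) * z (n - i) = _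
    rw [show n - (n - i) = i by omega]
  have hy1 : ∀ i, n < i → y i = 1 := fun i hi => by
    change z (n + 1 - i) = 1
    rw [show n + 1 - i = 0 by omega]
    rfl
  have hyrel := partial_product_relations (g := g) hy hy1
    (fun i hi => by
      have := hgen.triple (i + 1) ⟨by omega, by omega⟩ ⟨by omega, by omega⟩ ⟨by omega, by omega⟩
      simpa [g, add_assoc] using this)
    (fun i j hij hj => hgen.comm i ⟨by omega, by omega⟩ j ⟨by omega, by omega⟩ (by omega))
  -- `y k` is trivial for `k > n`, so the sequence is continued by conjugation with `y 0` instead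
  let x : ℕ → G (Set.Icc (0 : ℤ) n) := fun k => match k with
    | 0 => y 0
    | k + 1 => (y 0 ^ k)⁻¹ * y 1 * y 0 ^ k
  have hx0 : ∀ k, 1 ≤ k → x k * x 0 = x 0 * x (k + 1) := fun k hk => by
    obtain ⟨k, rfl⟩ : ∃ l, k = l + 1 := ⟨k - 1, by omega⟩
    change (y 0 ^ k)⁻¹ * y 1 * y 0 ^ k * y 0 = y 0 * ((y 0 ^ (k + 1))⁻¹ * y 1 * y 0 ^ (k + 1))
    rw [pow_succ]
    group
  have hxy : ∀ k ≤ n, x k = y k := fun k => by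
    induction k with
    | zero => exact fun _ => rfl
    | succ k ih =>
      intro hk
      rcases Nat.eq_zero_or_pos k with rfl | hk0
      · simp [x]
      · have h1 := hx0 k hk0
        rw [ih (by omega), show x 0 = y 0 from rfl, hyrel 0 k hk0 (by omega)] at h1
        exact (mul_left_cancel h1).symm
  have hφy : ∀ d i, i + d = n → φ (y i) = X i := by
    intro d
    induction d with
    | zero =>
      intro i hi
      rw [hy i (by omega), hy1 (i + 1) (by omega), mul_one,
        (satisfies_bumpEnd n).lift_gen ⟨by omega, by omega⟩, bumpEnd, if_neg (by omega)]
      rfl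
    | succ d ih =>
      intro i hi
      rw [hy i (by omega), map_mul, ih (i + 1) (by omega),
        (satisfies_bumpEnd n).lift_gen ⟨by omega, by omega⟩, bumpEnd, if_pos (by omega)]
      exact (X_eq_bump_mul i).symm
  refine ⟨x, relations_of_two hx0 ?_ ?_, ?_, fun k => ?_⟩
  · rw [hxy 1 (by omega), hxy 2 (by omega), hxy 3 (by omega)]
    exact hyrel 1 2 (by omega) (by omega)
  · rw [hxy 1 (by omega), hxy 3 (by omega), hxy 4 (by omega)]
    exact hyrel 1 3 (by omega) (by omega)
  · rw [eq_top_iff, ← closure_gen, Subgroup.closure_le]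
    have hmem : ∀ i, y i ∈ Subgroup.closure (Set.range x) := fun i => by
      rcases le_or_gt i n with h | h
      · rw [← hxy i h]; exact Subgroup.subset_closure ⟨i, rfl⟩
      · rw [hy1 i h]; exact one_mem _
    rintro _ ⟨i, hi, rfl⟩
    rw [Set.mem_Icc] at hi
    lift i to ℕ using hi.1
    have e : g i = y i * (y (i + 1))⁻¹ := by rw [hy i (by omega), mul_inv_cancel_right]
    change g i ∈ _
    rw [e]
    exact mul_mem (hmem _) (inv_mem (hmem _))
  · induction k with
    | zero => exact hφy n 0 (by omega)
    | succ k ih =>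
      rcases Nat.eq_zero_or_pos k with rfl | hk0
      · rw [hxy 1 (by omega)]
        exact hφy (n - 1) 1 (by omega)
      · have h1 := congrArg φ (hx0 k hk0)
        rw [map_mul, map_mul, ih, show φ (x 0) = X 0 from hφy n 0 (by omega), X_mul_X hk0] at h1
        exact (mul_left_cancel h1).symm

theorem lift_bumpEnd_injective {n : ℕ} (hn : 4 ≤ n) :
    Function.Injective (satisfies_bumpEnd n).lift := by
  obtain ⟨x, hx, hgen, hφ⟩ := exists_sequence_of_four_le hn
  exact injective_of_map_eq_X hx hgen _ hφ

theorem lift_bumpEnd_surjective {n : ℕ} (hn : 4 ≤ n) :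
    Function.Surjective (satisfies_bumpEnd n).lift := by
  obtain ⟨x, -, -, hφ⟩ := exists_sequence_of_four_le hn
  rw [← MonoidHom.range_eq_top, eq_top_iff, ← closure_range_X, Subgroup.closure_le]
  rintro _ ⟨k, rfl⟩
  exact ⟨x k, hφ k⟩

/-! ### Generators indexed by the natural numbers: the group `D` -/

/-- Every element of `G ℕ` comes from finitely many generators. -/
theorem exists_lift_gen_Icc (w : G (Set.Ici (0 : ℤ))) : ∃ n : ℕ, 4 ≤ n ∧
    w ∈ (((satisfies_gen (Set.Ici (0 : ℤ))).mono
      (Set.Icc_subset_Ici_self : Set.Icc (0 : ℤ) n ⊆ _)).lift).range := by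
  simp only [Satisfies.range_lift]
  have hmono : ∀ {m n : ℕ}, m ≤ n → Subgroup.closure (gen (Set.Ici (0 : ℤ)) '' Set.Icc (0 : ℤ) m) ≤
      Subgroup.closure (gen (Set.Ici (0 : ℤ)) '' Set.Icc (0 : ℤ) n) := fun h =>
    Subgroup.closure_mono (Set.image_mono (Set.Icc_subset_Icc_right (by exact_mod_cast h)))
  have hw : w ∈ Subgroup.closure (gen (Set.Ici (0 : ℤ)) '' Set.Ici 0) :=
    closure_gen _ ▸ Subgroup.mem_top w
  induction hw using Subgroup.closure_induction with
  | mem x hx =>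
    obtain ⟨i, hi, rfl⟩ := hx
    rw [Set.mem_Ici] at hi
    exact ⟨i.toNat + 4, by omega, Subgroup.subset_closure ⟨i, ⟨hi, by omega⟩, rfl⟩⟩
  | one => exact ⟨4, le_rfl, one_mem _⟩
  | mul a b _ _ ha hb =>
    obtain ⟨m, hm, ha⟩ := ha
    obtain ⟨n, hn, hb⟩ := hb
    exact ⟨max m n, by omega, mul_mem (hmono (le_max_left _ _) ha) (hmono (le_max_right _ _) hb)⟩
  | inv a _ ha =>
    obtain ⟨m, hm, ha⟩ := ha
    exact ⟨m, hm, inv_mem ha⟩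

theorem X_inv_squeeze_of_lt {i m : ℕ} (h : i < m) (t : I) :
    (X i)⁻¹.1 (squeeze m t) = squeeze (m + 1) ((X i)⁻¹.1 t) := by
  conv_lhs => rw [← val_apply_inv_val (X i) t, ← X_squeeze_of_lt h, inv_val_apply_val]

theorem X_inv_squeeze_self (m : ℕ) (t : I) : (X m)⁻¹.1 (squeeze m t) = squeeze (m + 1) t := by
  rw [← X_squeeze_self, inv_val_apply_val]

/-- The map `squeeze (n + 1)` conjugates the generators of `F` from `G {0, …, n}` to the bumps. -/
theorem bump_squeeze {i n : ℕ} (h : i ≤ n) (t : I) :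
    (bump i).1 (squeeze (n + 1) t) = squeeze (n + 1) ((bumpEnd n i).1 t) := by
  rw [bump, mul_val_apply, bumpEnd]
  rcases h.eq_or_lt with rfl | h
  · rw [X_inv_squeeze_self, X_squeeze_of_lt (Nat.lt_succ_self _), if_neg (lt_irrefl _)]
    rfl
  · rw [X_inv_squeeze_of_lt (by omega), X_squeeze_of_lt (by omega), if_pos (by omega)]
    rfl

/-- An element of the kernel comes from some `G {0, …, n}`, where `squeeze (n + 1)` shows that it
acts trivially through the isomorphism with `F` as well. -/
theorem lift_bump_injective : Function.Injective satisfies_bump.lift := by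
  rw [injective_iff_map_eq_one]
  intro w hw
  obtain ⟨n, hn, v, rfl⟩ := exists_lift_gen_Icc w
  set ι := ((satisfies_gen (Set.Ici (0 : ℤ))).mono
    (Set.Icc_subset_Ici_self : Set.Icc (0 : ℤ) n ⊆ _)).lift
  have h1 : (satisfies_bumpEnd n).lift v = 1 := by
    refine eq_one_of_intertwine (φ := satisfies_bump.lift.comp ι) (squeeze_injective (n + 1))
      (fun i hi t => ?_) hw
    rw [MonoidHom.comp_apply, Satisfies.lift_gen _ hi, Satisfies.lift_gen _ hi,
      Satisfies.lift_gen _ (Set.Icc_subset_Ici_self hi)]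
    rw [Set.mem_Icc] at hi
    lift i to ℕ using hi.1
    exact bump_squeeze (by omega) t
  rw [(injective_iff_map_eq_one _).1 (lift_bumpEnd_injective hn) v h1, map_one]

theorem image_bump : (fun i : ℤ => bump i.toNat) '' Set.Ici 0 = Set.range bump := by
  ext f
  constructor
  · rintro ⟨i, -, rfl⟩
    exact ⟨_, rfl⟩
  · rintro ⟨i, rfl⟩
    exact ⟨i, by simp, by simp⟩

theorem normal_closure_bump : (Subgroup.closure (Set.range bump)).Normal := by
  have hb : ∀ i, bump i ∈ Subgroup.closure (Set.range bump) :=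
    fun i => Subgroup.subset_closure ⟨i, rfl⟩
  refine normal_of_X fun j => mem_closure_iff_conj_mem ?_ ?_
  · rintro _ ⟨i, rfl⟩
    exact X_conj_mem (fun i _ => hb i) (hb i) (m := i + 2) fun k hk => commute_bump_X hk
  · rintro _ ⟨i, rfl⟩
    rcases lt_trichotomy i j with h | rfl | h
    · obtain ⟨j, rfl⟩ : ∃ l, j = l + 1 := ⟨j - 1, by omega⟩
      rcases (show i ≤ j by omega).eq_or_lt with rfl | h
      · rw [X_succ_inv_conj_bump]
        exact mul_mem (hb _) (hb _)
      · rw [mul_assoc, (commute_bump_X (show i + 2 ≤ j + 1 by omega)).eq, inv_mul_cancel_left]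
        exact hb i
    · rw [X_inv_conj_bump_self]
      exact mul_mem (hb _) (hb _)
    · rw [X_inv_conj_bump_of_lt h]
      exact hb _

/-- Modulo the bumps, Thompson's group is generated by `X 0`, whose nontrivial powers are not in
`D`. -/
theorem closure_bump : Subgroup.closure (Set.range bump) = D := by
  have hle : Subgroup.closure (Set.range bump) ≤ D := by
    rw [Subgroup.closure_le]
    rintro _ ⟨i, rfl⟩
    exact X_mul_X_succ_inv_mem_D i
  refine le_antisymm hle fun f hf => ?_
  have := normal_closure_bump
  set K := Subgroup.closure (Set.range bump)
  have hX : ∀ j, (QuotientGroup.mk' K) (X j) = QuotientGroup.mk' K (X 0) := fun j => by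
    induction j with
    | zero => rfl
    | succ j ih =>
      have hb : QuotientGroup.mk' K (bump j) = 1 :=
        (QuotientGroup.eq_one_iff _).2 (Subgroup.subset_closure ⟨j, rfl⟩)
      rw [← ih, X_eq_bump_mul j, map_mul, hb, one_mul]
  have htop : (⊤ : Subgroup F) ≤
      (Subgroup.zpowers (QuotientGroup.mk' K (X 0))).comap (QuotientGroup.mk' K) := by
    rw [← closure_range_X, Subgroup.closure_le]
    rintro _ ⟨j, rfl⟩
    exact ⟨1, by simpa using (hX j).symm⟩
  obtain ⟨m, hm⟩ := htop (Subgroup.mem_top f)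
  have hK : f * (X 0 ^ m)⁻¹ ∈ K := by
    rw [← QuotientGroup.eq_one_iff]
    change QuotientGroup.mk' K (f * (X 0 ^ m)⁻¹) = 1
    rw [map_mul, map_inv, map_zpow, ← hm, mul_inv_cancel]
  have hD : X 0 ^ m ∈ D := by
    have h := mul_mem (inv_mem (hle hK)) hf
    simpa using h
  rw [eq_zero_of_X_zero_zpow_mem_D hD, zpow_zero, inv_one, mul_one] at hK
  exact hK

/-! ### Generators indexed by the integers: the commutator subgroup -/

/-- The bumps, extended to all integer indices: `X 0` conjugates `zBump (i + 1)` to `zBump i`. For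
`i ≥ 1` this is `bump i`. -/
noncomputable def zBump (i : ℤ) : F := X 0 ^ (1 - i) * bump 1 * X 0 ^ (i - 1)

theorem zBump_add (i m : ℤ) : zBump (i + m) = (X 0 ^ m)⁻¹ * zBump i * X 0 ^ m := by
  simp only [zBump]
  group

theorem zBump_natCast_succ (k : ℕ) : zBump (k + 1) = bump (k + 1) := by
  induction k with
  | zero => simp [zBump]
  | succ k ih =>
    rw [← X_inv_conj_bump_of_lt (show 0 < k + 1 by omega), ← ih]
    push_cast
    rw [zBump_add _ 1, zpow_one]

theorem satisfies_zBump : Satisfies Set.univ zBump := by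
  have key : ∀ i j m : ℤ, i = j + m → zBump i = MulAut.conj (X 0 ^ m)⁻¹ (zBump j) := by
    rintro i j m rfl
    rw [zBump_add, MulAut.conj_apply, inv_inv]
  refine ⟨fun i _ _ _ => ?_, fun i _ j _ hij => ?_⟩
  · have h1 : zBump 1 = bump 1 := zBump_natCast_succ 0
    have h2 : zBump 2 = bump 2 := zBump_natCast_succ 1
    have h3 : zBump 3 = bump 3 := zBump_natCast_succ 2
    rw [key (i - 1) 1 (i - 2) (by ring), key i 2 (i - 2) (by ring), key (i + 1) 3 (i - 2) (by ring),
      h1, h2, h3]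
    simp only [← map_mul]
    rw [bump_triple 1]
  · obtain ⟨d, rfl⟩ : ∃ d : ℕ, j = d + i + 2 := ⟨(j - i - 2).toNat, by omega⟩
    have h1 : zBump 1 = bump 1 := zBump_natCast_succ 0
    rw [key i 1 (i - 1) (by ring), key (d + i + 2) ((d + 2 : ℕ) + 1) (i - 1) (by push_cast; ring),
      zBump_natCast_succ, h1]
    exact (commute_bump_bump (by omega)).map (MulAut.conj (X 0 ^ (i - 1))⁻¹)

theorem X_mul_X_zero_pow (k : ℕ) {m : ℕ} (hm : 1 ≤ m) : X m * X 0 ^ k = X 0 ^ k * X (m + k) := by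
  induction k with
  | zero => simp
  | succ k ih =>
    rw [pow_succ, ← mul_assoc, ih, mul_assoc, X_mul_X (by omega), ← mul_assoc, add_assoc]

theorem commute_zBump_X {i : ℤ} {m : ℕ} (hm : 1 ≤ m) (him : i + 2 ≤ m) :
    Commute (zBump i) (X m) := by
  rcases le_or_gt 1 i with h | h
  · obtain ⟨k, rfl⟩ : ∃ k : ℕ, i = k + 1 := ⟨(i - 1).toNat, by omega⟩
    rw [zBump_natCast_succ]
    exact commute_bump_X (by omega)
  · obtain ⟨k, rfl⟩ : ∃ k : ℕ, i = -k := ⟨(-i).toNat, by omega⟩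
    have e : zBump (-k) = X 0 ^ (k + 1) * bump 1 * (X 0 ^ (k + 1))⁻¹ := by
      rw [zBump, ← zpow_natCast, ← zpow_neg]
      push_cast
      congr 2 <;> ring_nf
    have h1 := X_mul_X_zero_pow (k + 1) hm
    have h2 : Commute (bump 1) (X (m + (k + 1))) := commute_bump_X (by omega)
    rw [e]
    change _ * _ * _ * _ = _
    calc _ = X 0 ^ (k + 1) * (bump 1 * ((X 0 ^ (k + 1))⁻¹ * X m)) := by simp only [mul_assoc]
      _ = X 0 ^ (k + 1) * (bump 1 * (X (m + (k + 1)) * (X 0 ^ (k + 1))⁻¹)) := by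
        congr 2
        rw [inv_mul_eq_iff_eq_mul, ← mul_assoc, ← h1, mul_inv_cancel_right]
      _ = X 0 ^ (k + 1) * X (m + (k + 1)) * bump 1 * (X 0 ^ (k + 1))⁻¹ := by
        rw [← mul_assoc (bump 1), h2.eq]; simp only [mul_assoc]
      _ = _ := by rw [← h1]; simp only [mul_assoc]

/-- Every element of `G ℤ` comes from the generators with indices at least `-m`, for some `m`. -/
theorem exists_lift_gen_shift (w : G (Set.univ : Set ℤ)) : ∃ m : ℕ,
    w ∈ (((satisfies_gen Set.univ).shift (-m)).mono
      (Set.subset_univ (Set.Ici 0))).lift.range := by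
  simp only [Satisfies.range_lift]
  have hmono : ∀ {m n : ℕ}, m ≤ n →
      Subgroup.closure ((fun i : ℤ => gen Set.univ (i + -m)) '' Set.Ici 0) ≤
      Subgroup.closure ((fun i : ℤ => gen Set.univ (i + -n)) '' Set.Ici 0) := fun {m n} h => by
    refine Subgroup.closure_mono ?_
    rintro _ ⟨i, hi, rfl⟩
    rw [Set.mem_Ici] at hi
    refine ⟨i + n - m, by rw [Set.mem_Ici]; omega, ?_⟩
    change gen Set.univ (i + n - m + -n) = gen Set.univ (i + -m)
    congr 1
    ring
  have hw : w ∈ Subgroup.closure (gen (Set.univ : Set ℤ) '' Set.univ) :=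
    closure_gen _ ▸ Subgroup.mem_top w
  induction hw using Subgroup.closure_induction with
  | mem x hx =>
    obtain ⟨i, -, rfl⟩ := hx
    refine ⟨i.natAbs, Subgroup.subset_closure ⟨i + i.natAbs, ?_, ?_⟩⟩
    · rw [Set.mem_Ici]; omega
    · change gen Set.univ (i + i.natAbs + -i.natAbs) = _
      rw [add_neg_cancel_right]
  | one => exact ⟨0, one_mem _⟩
  | mul a b _ _ ha hb =>
    obtain ⟨m, ha⟩ := ha
    obtain ⟨n, hb⟩ := hb
    exact ⟨max m n, mul_mem (hmono (le_max_left _ _) ha) (hmono (le_max_right _ _) hb)⟩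
  | inv a _ ha =>
    obtain ⟨m, ha⟩ := ha
    exact ⟨m, inv_mem ha⟩

theorem X_inv_toRightHalf (n : ℕ) (t : I) :
    (X (n + 1))⁻¹.1 (toRightHalf t) = toRightHalf ((X n)⁻¹.1 t) := by
  conv_lhs => rw [← val_apply_inv_val (X n) t, ← X_toRightHalf, inv_val_apply_val]

/-- After conjugation with a power of `X 0`, an element of the kernel comes from `G ℕ`, with `g i`
acting as `bump (i + 1)`; this is the action of `bump i` on the right half of the interval. -/
theorem lift_zBump_injective : Function.Injective satisfies_zBump.lift := by
  rw [injective_iff_map_eq_one]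
  intro w hw
  obtain ⟨m, v, rfl⟩ := exists_lift_gen_shift w
  set κ := (((satisfies_gen Set.univ).shift (-m)).mono (Set.subset_univ (Set.Ici 0))).lift
  let s : Satisfies (Set.Ici 0) fun i => zBump (i + 1) :=
    (satisfies_zBump.shift 1).mono (Set.subset_univ _)
  have hconj : satisfies_zBump.lift.comp κ =
      (MulAut.conj (X 0 ^ (m + 1 : ℤ))).toMonoidHom.comp s.lift := by
    refine hom_ext_gen fun i hi => ?_
    rw [MonoidHom.comp_apply, MonoidHom.comp_apply, Satisfies.lift_gen _ hi, s.lift_gen hi,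
      satisfies_zBump.lift_gen trivial]
    change zBump (i + -m) = X 0 ^ (m + 1 : ℤ) * zBump (i + 1) * (X 0 ^ (m + 1 : ℤ))⁻¹
    rw [show i + -(m : ℤ) = i + 1 + -(m + 1 : ℤ) by ring, zBump_add (i + 1), zpow_neg, inv_inv]
  have h1 : s.lift v = 1 := by
    have h := DFunLike.congr_fun hconj v
    rw [MonoidHom.comp_apply, hw] at h
    exact (map_eq_one_iff (MulAut.conj (X 0 ^ (m + 1 : ℤ))) (MulEquiv.injective _)).1 h.symm
  have h2 : satisfies_bump.lift v = 1 := by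
    refine eq_one_of_intertwine toRightHalf_injective (fun i hi t => ?_) h1
    rw [s.lift_gen hi, satisfies_bump.lift_gen hi]
    rw [Set.mem_Ici] at hi
    lift i to ℕ using hi
    rw [zBump_natCast_succ, bump, mul_val_apply, X_inv_toRightHalf, X_toRightHalf]
    rfl
  rw [(injective_iff_map_eq_one _).1 lift_bump_injective v h2, map_one]

theorem normal_closure_zBump : (Subgroup.closure (Set.range zBump)).Normal := by
  have hz : ∀ i, zBump i ∈ Subgroup.closure (Set.range zBump) :=
    fun i => Subgroup.subset_closure ⟨i, rfl⟩
  have hb : ∀ i, 1 ≤ i → bump i ∈ Subgroup.closure (Set.range zBump) := fun i hi => by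
    obtain ⟨i, rfl⟩ : ∃ l, i = l + 1 := ⟨i - 1, by omega⟩
    rw [← zBump_natCast_succ]
    exact hz _
  have h0 : ∀ i, (X 0)⁻¹ * zBump i * X 0 = zBump (i + 1) := fun i => by
    rw [zBump_add, zpow_one]
  have h0' : ∀ i, X 0 * zBump i * (X 0)⁻¹ = zBump (i - 1) := fun i => by
    rw [sub_eq_add_neg, zBump_add, zpow_neg_one, inv_inv]
  -- the two nontrivial conjugations, transported to all positions
  have hself : ∀ k : ℕ, (X (k + 1))⁻¹ * zBump (k + 1) * X (k + 1) =
      zBump (k + 1) * zBump (k + 2) := fun k => by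
    rw [zBump_natCast_succ, X_inv_conj_bump_self, ← zBump_natCast_succ (k + 1)]
    push_cast
    ring_nf
  have hpred : ∀ k : ℕ, (X (k + 1))⁻¹ * zBump k * X (k + 1) = zBump k * zBump (k + 1) := fun k => by
    have h1 := X_succ_inv_conj_bump (k + 1)
    rw [← zBump_natCast_succ, ← zBump_natCast_succ] at h1
    have h3 : (X 0)⁻¹ * X (k + 1) = X (k + 2) * (X 0)⁻¹ := X_inv_mul_X (by omega)
    have e0 := h0' (k + 1)
    have e1 := h0' ((k + 1 : ℕ) + 1)
    rw [add_sub_cancel_right] at e0 e1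
    push_cast at e1 h1
    rw [← e1, ← e0]
    calc _ = ((X 0)⁻¹ * X (k + 1))⁻¹ * zBump (k + 1) * ((X 0)⁻¹ * X (k + 1)) := by group
      _ = X 0 * ((X (k + 2))⁻¹ * zBump (k + 1) * X (k + 2)) * (X 0)⁻¹ := by rw [h3]; group
      _ = X 0 * (zBump (k + 1) * zBump (k + 1 + 1)) * (X 0)⁻¹ := by rw [h1]
      _ = _ := by group
  refine normal_of_X fun j => mem_closure_iff_conj_mem ?_ ?_
  · rintro _ ⟨i, rfl⟩
    rcases Nat.eq_zero_or_pos j with rfl | hj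
    · rw [h0']; exact hz _
    · exact X_conj_mem (fun i hi => hb i (by omega)) (hz i) (m := i.toNat + 2) fun k hk =>
        commute_zBump_X (by omega) (by omega)
  · rintro _ ⟨i, rfl⟩
    rcases Nat.eq_zero_or_pos j with rfl | hj
    · rw [h0]; exact hz _
    obtain ⟨k, rfl⟩ : ∃ l, j = l + 1 := ⟨j - 1, by omega⟩
    rcases lt_trichotomy i k with h | rfl | h
    · rw [mul_assoc, (commute_zBump_X (show 1 ≤ k + 1 by omega)
        (show i + 2 ≤ (k + 1 : ℕ) by omega)).eq, inv_mul_cancel_left]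
      exact hz i
    · rw [hpred]
      exact mul_mem (hz _) (hz _)
    · obtain ⟨l, rfl⟩ : ∃ l : ℕ, i = l + 1 := ⟨(i - 1).toNat, by omega⟩
      rcases (show k ≤ l by omega).eq_or_lt with rfl | h
      · rw [hself]
        exact mul_mem (hz _) (hz _)
      · rw [zBump_natCast_succ, X_inv_conj_bump_of_lt (by omega)]
        exact hb _ (by omega)

theorem eq_one_of_triple {A : Type*} [CommGroup A] {a b c : A}
    (h : a * b * c = b * c * a * b) : b = 1 := by
  have e : b * c * a * b = b * (a * b * c) := by ac_rfl
  rw [e] at h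
  exact right_eq_mul.1 h

/-- The relations make every `zBump i` trivial in any abelian quotient. Conversely, modulo the
elements `zBump i` the generators `X k`, `k ≥ 1`, become equal, so that `X 1 * X 0 = X 0 * X 2`
makes all generators commute. -/
theorem closure_zBump : Subgroup.closure (Set.range zBump) = commutator F := by
  refine le_antisymm ?_ ?_
  · rw [Subgroup.closure_le]
    rintro _ ⟨i, rfl⟩
    have h := congrArg (Abelianization.of (G := F))
      (satisfies_zBump.triple i trivial trivial trivial)
    rw [SetLike.mem_coe, ← Abelianization.ker_of, MonoidHom.mem_ker]
    simp only [map_mul] at h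
    exact eq_one_of_triple h
  · have := normal_closure_zBump
    set K := Subgroup.closure (Set.range zBump)
    let π := QuotientGroup.mk' K
    have hX : ∀ j, π (X (j + 1)) = π (X 1) := fun j => by
      induction j with
      | zero => rfl
      | succ j ih =>
        have hb : π (bump (j + 1)) = 1 := (QuotientGroup.eq_one_iff _).2 (by
          rw [← zBump_natCast_succ]; exact Subgroup.subset_closure ⟨_, rfl⟩)
        rw [← ih, X_eq_bump_mul (j + 1), map_mul, hb, one_mul]
    have h01 : Commute (π (X 1)) (π (X 0)) := by
      have h := congrArg π (X_mul_X (show 0 < 1 by omega))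
      rw [map_mul, map_mul, hX 1] at h
      exact h
    have hcomm : ∀ i j, Commute (π (X i)) (π (X j)) := by
      rintro (_ | i) (_ | j)
      · exact Commute.refl _
      · rw [hX]; exact h01.symm
      · rw [hX]; exact h01
      · rw [hX i, hX j]
    have htop : ∀ f : F, ∀ i, Commute (π f) (π (X i)) := fun f i => by
      have hf : f ∈ Subgroup.closure (Set.range X) := closure_range_X ▸ Subgroup.mem_top f
      induction hf using Subgroup.closure_induction with
      | mem x hx => obtain ⟨j, rfl⟩ := hx; exact hcomm j i
      | one => rw [map_one]; exact Commute.one_left _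
      | mul a b _ _ ha hb => rw [map_mul]; exact ha.mul_left hb
      | inv a _ ha => rw [map_inv]; exact ha.inv_left
    have hall : ∀ f g : F, Commute (π f) (π g) := fun f g => by
      have hg : g ∈ Subgroup.closure (Set.range X) := closure_range_X ▸ Subgroup.mem_top g
      induction hg using Subgroup.closure_induction with
      | mem x hx => obtain ⟨j, rfl⟩ := hx; exact htop f j
      | one => rw [map_one]; exact Commute.one_right _
      | mul a b _ _ ha hb => rw [map_mul]; exact ha.mul_right hb
      | inv a _ ha => rw [map_inv]; exact ha.inv_right
    refine Subgroup.Normal.quotient_commutative_iff_commutator_le.1 ⟨⟨fun a b => ?_⟩⟩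
    obtain ⟨f, rfl⟩ := QuotientGroup.mk'_surjective K a
    obtain ⟨g, rfl⟩ := QuotientGroup.mk'_surjective K b
    exact hall f g

end Thompson

theorem theorem3p1 :
    (∀ n : ℕ, 4 ≤ n → Nonempty (Thompson.G (Set.Icc (0 : ℤ) n) ≃* Thompson.F)) ∧
    Nonempty (Thompson.G (Set.univ : Set ℤ) ≃* commutator Thompson.F) ∧
    Nonempty (Thompson.G (Set.Ici (0 : ℤ)) ≃* Thompson.D) := by
  refine ⟨fun n hn => ⟨MulEquiv.ofBijective _ ⟨Thompson.lift_bumpEnd_injective hn,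
    Thompson.lift_bumpEnd_surjective hn⟩⟩, ⟨?_⟩, ⟨?_⟩⟩
  · refine (MonoidHom.ofInjective Thompson.lift_zBump_injective).trans
      (MulEquiv.subgroupCongr ?_)
    rw [Thompson.Satisfies.range_lift, Set.image_univ, Thompson.closure_zBump]
  · refine (MonoidHom.ofInjective Thompson.lift_bump_injective).trans (MulEquiv.subgroupCongr ?_)
    rw [Thompson.Satisfies.range_lift, Thompson.image_bump, Thompson.closure_bump]
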